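/- Let $B$ (blue) and $R$ (red) be finite disjoint sets of points in the plane such that no three distinct points of $B\cup R$ are collinear and every red point lies in the interior of the convex hull $\mathrm{Conv}(B)$. A polygonization of $B$ is a simple closed polygon whose vertex set is $B$; it excludes $R$ if every point of $R$ lies in the exterior of the polygon (the unbounded component of the complement of its boundary). For all integers $n\ge 3$, $l\ge 1$ and $0\le k\le 2l-2$ there are such sets $B$ and $R$ for which $|B|=n+k$, $\mathrm{Conv}(B)$ has exactly $n$ vertices, the other $k$ points of $B$ lie in the interior of $\mathrm{Conv}(B)$, $|R|=l$, and no polygonization of $B$ excludes $R$. Consequently, for every $l\ge 1$, if $K(l)\in\{0,1,2,\dots\}\cup\{\infty\}$ denotes the least integer $K$ such that, for every $n \ge 3$ and $k \ge K$, every such pair $(B,R)$ with $|R|=l$, with $n$ hull vertices and with $k$ blue points in the interior of $\mathrm{Conv}(B)$ admits a polygonization of $B$ excluding $R$ ($K(l)=\infty$ if there is no such $K$), then $K(l)\ge 2l-1$. -/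

import Mathlib

/-- The Euclidean plane. -/
abbrev Plane : Type := EuclideanSpace ℝ (Fin 2)

/-- A set of points in the plane is in general position if no three distinct points of it are
collinear. -/
def GeneralPosition (S : Set Plane) : Prop :=
  ∀ a ∈ S, ∀ b ∈ S, ∀ c ∈ S, a ≠ b → a ≠ c → b ≠ c → ¬ Collinear ℝ {a, b, c}

/-- The vertices (0-dimensional faces) of the convex hull of a set. -/
def hullVertices (S : Set Plane) : Set Plane :=
  (convexHull ℝ S).extremePoints ℝ

/-- A bicoloured configuration: finite disjoint sets `B` (blue) and `R` (red) whose union is in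
general position, such that the convex hull of `B` has `n` vertices, `k` blue points lie in the
interior of this hull, and there are `l` red points, all of them in the interior of this hull. -/
structure IsConfiguration (n k l : ℕ) (B R : Finset Plane) : Prop where
  disjoint : Disjoint B R
  generalPosition : GeneralPosition ((B : Set Plane) ∪ (R : Set Plane))
  card_blue : B.card = n + k
  card_red : R.card = l
  card_hull : (hullVertices (B : Set Plane)).ncard = n
  card_interior : ((B : Set Plane) ∩ interior (convexHull ℝ (B : Set Plane))).ncard = k
  red_interior : (R : Set Plane) ⊆ interior (convexHull ℝ (B : Set Plane))

/-- A closed polygon with `m` vertices is simple if it has at least three vertices, these are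
distinct, two consecutive edges meet only in their common vertex, and any other two distinct edges
are disjoint. -/
structure IsSimplePolygon {m : ℕ} (p : Polygon Plane m) : Prop where
  three_le : 3 ≤ m
  injective : Function.Injective p.vertices
  consecutive : ∀ i : Fin m,
    p.edgeSet ℝ i ∩ p.edgeSet ℝ (finRotate m i) = {p.vertices (finRotate m i)}
  nonconsecutive : ∀ i j : Fin m, i ≠ j → j ≠ finRotate m i → i ≠ finRotate m j →
    Disjoint (p.edgeSet ℝ i) (p.edgeSet ℝ j)

/-- A polygonization of `S` is a simple polygon whose set of vertices is `S`. -/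
def IsPolygonization {m : ℕ} (p : Polygon Plane m) (S : Set Plane) : Prop :=
  IsSimplePolygon p ∧ Set.range p.vertices = S

/-- The exterior of a polygon: the points off its boundary whose connected component in the
complement of the boundary is unbounded. -/
def polygonExterior {m : ℕ} (p : Polygon Plane m) : Set Plane :=
  {x | x ∉ p.boundary ℝ ∧
    ¬ Bornology.IsBounded (connectedComponentIn (p.boundary ℝ)ᶜ x)}

/-- There is a polygonization of the blue points that excludes all the red points, that is, all
the red points lie in its exterior. -/
def HasExcludingPolygonization (B R : Finset Plane) : Prop :=
  ∃ (m : ℕ) (p : Polygon Plane m),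
    IsPolygonization p (B : Set Plane) ∧ (R : Set Plane) ⊆ polygonExterior p

/-- Having at least `K` interior blue points is sufficient: every configuration with `l` red points
and at least `K` interior blue points (and any number of blue hull vertices) has a polygonization
of the blue points that excludes all the red points. -/
def IsSufficient (l K : ℕ) : Prop :=
  ∀ (n k : ℕ) (B R : Finset Plane), 3 ≤ n → K ≤ k → IsConfiguration n k l B R →
    HasExcludingPolygonization B R

/-- `minInterior l` is the least sufficient number of interior blue points for `l` red points
(`⊤` if no number were sufficient). -/
noncomputable def minInterior (l : ℕ) : ℕ∞ :=
  ⨅ (K : ℕ) (_ : IsSufficient l K), (K : ℕ∞)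

/-! Blue points: the apex `(0, -w)` and the points of the parabola `y = x ^ 2` with abscissas `0, …,
N - 1`, where `N = n + k - 1` and `w` is slightly more than `(k + 1) ^ 2`. This depth makes exactly
the points `1, …, k` interior. Red points: one just below the chord from `0` to `N - 1`, at abscissa
`1 / 2`, and one on the parabola at each `j + 1 / 2` with `j ≤ k` odd. These number at most `l`
because `k ≤ 2 * l - 2`; harmless extra points make up the difference.

Suppose that a polygonization excludes them all. A segment from the apex to a label above `k + 1`
would separate the labels `0` and `k + 1`, so the neighbours of the apex have labels at most `k + 1`
(`label_le_of_adjacent_apex`). The downward ray from a red point of the parabola misses every chord,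
so it can meet only the two edges at the apex; it cannot meet exactly one of them, so both
neighbours lie on the same side of it (`not_separated`). Hence their labels are consecutive. The
path through the apex then changes side of no edge avoiding it and these two neighbours, and every
edge off the apex must join consecutive labels or be the long chord from `0` to `N - 1`
(`succ_or_long`). The upward ray from the remaining red point rules out the long chord
(`not_long_edge`). Now the vertices labelled `0` and `N - 1` have too few possible neighbours unless
both are adjacent to the apex, which forces `N = 2`, and there the long chord is needed after all.

The topological input is `notMem_exterior_of_unique_crossing`: the winding number vanishes on the
exterior, but a ray crossed exactly once makes it nonzero. -/

/-! ### Winding numbers vanish on the exterior. -/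

/-- The identification of the plane with `ℂ`. -/
def toComplex (x : Plane) : ℂ := ⟨x 0, x 1⟩

theorem toComplex_injective : Function.Injective toComplex := by
  intro x y h
  have h0 := congrArg Complex.re h
  have h1 := congrArg Complex.im h
  ext i
  fin_cases i
  · exact h0
  · exact h1

theorem continuous_toComplex : Continuous toComplex := by
  have : toComplex = fun x : Plane => ((x 0 : ℝ) : ℂ) + ((x 1 : ℝ) : ℂ) * Complex.I := by
    funext x
    apply Complex.ext <;> simp [toComplex]
  rw [this]
  fun_prop

theorem norm_toComplex (x : Plane) : ‖toComplex x‖ = ‖x‖ := by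
  rw [EuclideanSpace.norm_eq, Complex.norm_eq_sqrt_sq_add_sq]
  simp [toComplex, Fin.sum_univ_two]

theorem arg_div_eq_sub {z w : ℂ} (hz : z ≠ 0) (hw : w ≠ 0)
    (h : w.arg - z.arg ∈ Set.Ioc (-Real.pi) Real.pi) :
    (w / z).arg = w.arg - z.arg := by
  have h1 := Complex.arg_div_coe_angle hw hz
  rw [← Real.Angle.coe_sub] at h1
  have h2 := congrArg Real.Angle.toReal h1
  rwa [Complex.arg_coe_angle_toReal_eq_arg, Real.Angle.toReal_coe_eq_self_iff.2 h] at h2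

/-- A nonpositive real quotient would mean that `a` and `b` lie in opposite directions from `x`, or
that one of them is `x`. This keeps each angle away from the branch cut of `arg`. -/
theorem div_mem_slitPlane {a b x : Plane} (h : x ∉ affineSegment ℝ a b) :
    (toComplex b - toComplex x) / (toComplex a - toComplex x) ∈ Complex.slitPlane := by
  by_contra hq
  have hax : toComplex a - toComplex x ≠ 0 := by
    intro h0
    have : a = x := toComplex_injective (sub_eq_zero.1 h0)
    exact h (this ▸ left_mem_affineSegment ℝ a b)
  set q := (toComplex b - toComplex x) / (toComplex a - toComplex x) with hqdef
  rw [Complex.mem_slitPlane_iff] at hq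
  push Not at hq
  obtain ⟨hre, him⟩ := hq
  have hmul : toComplex b - toComplex x = q * (toComplex a - toComplex x) := by
    rw [hqdef, div_mul_cancel₀ _ hax]
  have e0 := congrArg Complex.re hmul
  have e1 := congrArg Complex.im hmul
  simp only [Complex.mul_re, Complex.mul_im, him, Complex.sub_re, Complex.sub_im, toComplex] at e0 e1
  have hpos : (0 : ℝ) < 1 - q.re := by linarith
  apply h
  -- The parameter solves `b - x = q (a - x)` with `q` real and nonpositive for `x` on the line
  -- through `a` and `b`.
  refine ⟨1 / (1 - q.re), ⟨by positivity, ?_⟩, ?_⟩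
  · rw [div_le_one hpos]; linarith
  · ext i
    simp only [AffineMap.lineMap_apply, vsub_eq_sub, vadd_eq_add, PiLp.add_apply, PiLp.smul_apply,
      PiLp.sub_apply, smul_eq_mul]
    fin_cases i
    · simp only [Fin.zero_eta]
      field_simp
      linarith
    · simp only [Fin.mk_one]
      field_simp
      linarith

section Winding

variable {m : ℕ} (p : Polygon Plane m)

/-- The total angle (`2π` times the winding number) by which a polygon turns around a point. -/
noncomputable def totalAngle (x : Plane) : ℝ :=
  ∑ i, ((toComplex (p (finRotate m i)) - toComplex x) / (toComplex (p i) - toComplex x)).arg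

variable {p}

theorem not_mem_edge {x : Plane} (hx : x ∉ p.boundary ℝ) (i : Fin m) :
    x ∉ affineSegment ℝ (p i) (p (finRotate m i)) :=
  fun h => hx (Set.mem_iUnion.2 ⟨i, h⟩)

theorem sub_ne_zero_of_notMem_boundary {x : Plane} (hx : x ∉ p.boundary ℝ) (i : Fin m) :
    toComplex (p i) - toComplex x ≠ 0 := by
  intro h0
  have : p i = x := toComplex_injective (sub_eq_zero.1 h0)
  exact not_mem_edge hx i (this ▸ left_mem_affineSegment ℝ _ _)

theorem continuousOn_totalAngle : ContinuousOn (totalAngle p) (p.boundary ℝ)ᶜ := by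
  unfold totalAngle
  refine continuousOn_finsetSum _ fun i _ => ?_
  intro x hx
  refine ContinuousAt.continuousWithinAt ?_
  have hc := continuous_toComplex.continuousAt (x := x)
  exact (Complex.continuousAt_arg (div_mem_slitPlane (not_mem_edge hx i))).comp
    (f := fun x => (toComplex (p (finRotate m i)) - toComplex x) / (toComplex (p i) - toComplex x))
    ((continuousAt_const.sub hc).div (continuousAt_const.sub hc)
      (sub_ne_zero_of_notMem_boundary hx i))

theorem sum_finRotate_sub_eq_zero {A : Type*} [AddCommGroup A] (f : Fin m → A) :
    ∑ i, (f (finRotate m i) - f i) = 0 := by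
  rw [Finset.sum_sub_distrib, Equiv.sum_comp (finRotate m) f, sub_self]

/-- Modulo `2π` the argument of a quotient is a difference of arguments, so the sum around the cycle
telescopes. -/
theorem totalAngle_mem_zmultiples {x : Plane} (hx : x ∉ p.boundary ℝ) :
    totalAngle p x ∈ AddSubgroup.zmultiples (2 * Real.pi) := by
  have h : ((totalAngle p x : ℝ) : Real.Angle) = 0 := by
    unfold totalAngle
    rw [← Real.Angle.coe_coeHom, map_sum]
    simp only [Real.Angle.coe_coeHom]
    rw [Finset.sum_congr rfl fun i _ => Complex.arg_div_coe_angle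
      (sub_ne_zero_of_notMem_boundary hx (finRotate m i)) (sub_ne_zero_of_notMem_boundary hx i)]
    exact sum_finRotate_sub_eq_zero
      (fun i => ((toComplex (p i) - toComplex x).arg : Real.Angle))
  obtain ⟨n, hn⟩ := Real.Angle.coe_eq_zero_iff.1 h
  exact ⟨n, hn⟩

/-- Divided by `-x`, all the vectors from `x` to the vertices lie in the right half-plane, where
differences of arguments stay in `(-π, π)` and telescope exactly. -/
theorem totalAngle_eq_zero_of_large {x : Plane} (hx : ∀ i, ‖p i‖ < ‖x‖) : totalAngle p x = 0 := by
  -- The dummy index is needed: for `m = 0` nothing forces `x ≠ 0`.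
  have hx0 : ∀ _ : Fin m, toComplex x ≠ 0 := fun i h => by
    have := hx i
    rw [← norm_toComplex x, h, norm_zero] at this
    exact absurd this (not_lt.2 (norm_nonneg _))
  set u : Fin m → ℂ := fun i => 1 - toComplex (p i) / toComplex x with hu
  have hre : ∀ i, 0 < (u i).re := by
    intro i
    have h1 : ‖toComplex (p i) / toComplex x‖ < 1 := by
      rw [norm_div, div_lt_one (norm_pos_iff.2 (hx0 i)), norm_toComplex, norm_toComplex]
      exact hx i
    have h2 := Complex.re_le_norm (toComplex (p i) / toComplex x)
    simp only [hu, Complex.sub_re, Complex.one_re]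
    linarith
  have hne : ∀ i, u i ≠ 0 := fun i h => by
    have := hre i
    rw [h] at this
    simp at this
  rw [← sum_finRotate_sub_eq_zero (fun i => (u i).arg)]
  unfold totalAngle
  refine Finset.sum_congr rfl fun i _ => ?_
  have hquot : (toComplex (p (finRotate m i)) - toComplex x) / (toComplex (p i) - toComplex x)
      = u (finRotate m i) / u i := by
    have e : ∀ j, toComplex (p j) - toComplex x = -toComplex x * u j := by
      intro j
      have := hx0 j
      simp only [hu]
      field_simp
      ring
    rw [e, e, mul_div_mul_left _ _ (neg_ne_zero.2 (hx0 i))]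
  rw [hquot]
  apply arg_div_eq_sub (hne _) (hne _)
  have h1 := abs_lt.1 (Complex.abs_arg_lt_pi_div_two_iff.2 (Or.inl (hre i)))
  have h2 := abs_lt.1 (Complex.abs_arg_lt_pi_div_two_iff.2 (Or.inl (hre (finRotate m i))))
  constructor <;> linarith [h1.1, h1.2, h2.1, h2.2]

/-- A continuous function with values in a discrete set is constant on the component of `x`, and an
unbounded component contains points farther out than all vertices. -/
theorem totalAngle_eq_zero_of_mem_exterior {x : Plane} (hx : x ∈ polygonExterior p) :
    totalAngle p x = 0 := by
  obtain ⟨hxb, hunb⟩ := hx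
  set C := connectedComponentIn (p.boundary ℝ)ᶜ x with hC
  have hsub : C ⊆ (p.boundary ℝ)ᶜ := connectedComponentIn_subset _ _
  have hxC : x ∈ C := mem_connectedComponentIn hxb
  obtain ⟨y, hyC, hy⟩ : ∃ y ∈ C, ∀ i, ‖p i‖ < ‖y‖ := by
    by_contra! hcon
    apply hunb
    rw [isBounded_iff_forall_norm_le]
    refine ⟨∑ i, ‖p i‖, fun y hy => ?_⟩
    obtain ⟨i, hi⟩ := hcon y hy
    exact hi.trans (Finset.single_le_sum (f := fun i => ‖p i‖) (fun j _ => norm_nonneg _)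
      (Finset.mem_univ i))
  have hconst := isPreconnected_connectedComponentIn.constant_of_mapsTo
    (T := (AddSubgroup.zmultiples (2 * Real.pi) : Set ℝ))
    (SetLike.isDiscrete_iff_discreteTopology.2 inferInstance)
    (continuousOn_totalAngle.mono hsub)
    (fun z hz => totalAngle_mem_zmultiples (hsub hz)) hxC hyC
  rw [hconst, totalAngle_eq_zero_of_large hy]

end Winding

/-! ### Rays crossed exactly once. -/

/-- Whether the segment from `a` to `b` meets the vertical ray issuing from `r`, upwards if `ε = 1`
and downwards if `ε = -1`, assuming that neither of its ends lies on the line of the ray. -/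
def CrossesRay (ε : ℝ) (r a b : Plane) : Prop :=
  (a 0 - r 0) * (b 0 - r 0) < 0 ∧
    ε * (a 0 - r 0) * ((a 1 - r 1) * (b 0 - r 0) - (a 0 - r 0) * (b 1 - r 1)) < 0

/-- Whether the segment from `a` to `b` is disjoint from the vertical ray issuing from `r`, upwards
if `ε = 1` and downwards if `ε = -1`, assuming that neither of its ends lies on the line of the
ray. -/
def AvoidsRay (ε : ℝ) (r a b : Plane) : Prop :=
  0 < (a 0 - r 0) * (b 0 - r 0) ∨
    0 < ε * (a 0 - r 0) * ((a 1 - r 1) * (b 0 - r 0) - (a 0 - r 0) * (b 1 - r 1))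

theorem arg_mem_Ioo_of_im_pos {z : ℂ} (h : 0 < z.im) : z.arg ∈ Set.Ioo 0 Real.pi := by
  refine ⟨lt_of_le_of_ne (Complex.arg_nonneg_iff.2 h.le) fun h0 => ?_,
    lt_of_le_of_ne (Complex.arg_le_pi z) fun h0 => ?_⟩
  · exact h.ne' (Complex.arg_eq_zero_iff.1 h0.symm).2
  · exact h.ne' (Complex.arg_eq_pi_iff.1 h0).2

theorem arg_mem_Ioo_of_im_neg {z : ℂ} (h : z.im < 0) : z.arg ∈ Set.Ioo (-Real.pi) 0 :=
  ⟨Complex.neg_pi_lt_arg z, Complex.arg_neg_iff.2 h⟩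

theorem norm_mul_norm_mul_sin_arg_sub (z w : ℂ) :
    ‖z‖ * ‖w‖ * Real.sin (z.arg - w.arg) = z.im * w.re - z.re * w.im := by
  rw [Real.sin_sub, ← Complex.norm_mul_sin_arg z, ← Complex.norm_mul_cos_arg z,
    ← Complex.norm_mul_sin_arg w, ← Complex.norm_mul_cos_arg w]
  ring

theorem lt_pi_of_sin_pos {t : ℝ} (h1 : t < 2 * Real.pi) (hs : 0 < Real.sin t) :
    t < Real.pi := by
  by_contra! hcon
  have := Real.sin_nonpos_of_nonpos_of_neg_pi_le (x := t - 2 * Real.pi) (by linarith) (by linarith)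
  rw [Real.sin_sub_two_pi] at this
  linarith

theorem pi_lt_of_sin_neg {t : ℝ} (h0 : 0 < t) (hs : Real.sin t < 0) : Real.pi < t := by
  by_contra! hcon
  linarith [Real.sin_nonneg_of_nonneg_of_le_pi h0.le hcon]

/-- If `z` and `w` lie on opposite sides of the real axis, the segment between them meets it at
`(z.im * w.re - z.re * w.im) / (z.im - w.im)`. The hypothesis puts this point on the positive half,
away from the branch cut. -/
theorem arg_div_eq_sub_of_avoids {z w : ℂ} (hz : z.im ≠ 0) (hw : w.im ≠ 0)
    (h : 0 < z.im * w.im ∨ 0 < (z.im * w.re - z.re * w.im) * z.im) :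
    (w / z).arg = w.arg - z.arg := by
  have hz0 : z ≠ 0 := fun h => hz (by simp [h])
  have hw0 : w ≠ 0 := fun h => hw (by simp [h])
  have hpos : 0 < ‖z‖ * ‖w‖ := mul_pos (norm_pos_iff.2 hz0) (norm_pos_iff.2 hw0)
  have hsin := norm_mul_norm_mul_sin_arg_sub z w
  apply arg_div_eq_sub hz0 hw0
  rcases lt_or_gt_of_ne hz with hz1 | hz1 <;> rcases lt_or_gt_of_ne hw with hw1 | hw1
  · have a := arg_mem_Ioo_of_im_neg hz1
    have b := arg_mem_Ioo_of_im_neg hw1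
    constructor <;> linarith [a.1, a.2, b.1, b.2]
  · have a := arg_mem_Ioo_of_im_neg hz1
    have b := arg_mem_Ioo_of_im_pos hw1
    have hD := h.resolve_left (by nlinarith)
    have hs : Real.sin (z.arg - w.arg) < 0 := by
      by_contra! hcon
      nlinarith [mul_nonneg hpos.le hcon]
    have hs' : 0 < Real.sin (w.arg - z.arg) := by
      rw [← neg_sub, Real.sin_neg]
      linarith
    have := lt_pi_of_sin_pos (by linarith [a.1, b.2]) hs'
    constructor <;> linarith [a.1, a.2, b.1, b.2]
  · have a := arg_mem_Ioo_of_im_pos hz1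
    have b := arg_mem_Ioo_of_im_neg hw1
    have hD := h.resolve_left (by nlinarith)
    have hs : 0 < Real.sin (z.arg - w.arg) := by
      by_contra! hcon
      nlinarith [mul_nonneg hpos.le (neg_nonneg.2 hcon)]
    have := lt_pi_of_sin_pos (by linarith [a.2, b.1]) hs
    constructor <;> linarith [a.1, a.2, b.1, b.2]
  · have a := arg_mem_Ioo_of_im_pos hz1
    have b := arg_mem_Ioo_of_im_pos hw1
    constructor <;> linarith [a.1, a.2, b.1, b.2]

theorem arg_div_ne_sub_of_crosses {z w : ℂ} (h : z.im * w.im < 0)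
    (hD : (z.im * w.re - z.re * w.im) * z.im < 0) : (w / z).arg ≠ w.arg - z.arg := by
  have hz : z.im ≠ 0 := fun h0 => by simp [h0] at h
  have hw : w.im ≠ 0 := fun h0 => by simp [h0] at h
  have hz0 : z ≠ 0 := fun h => hz (by simp [h])
  have hw0 : w ≠ 0 := fun h => hw (by simp [h])
  have hpos : 0 < ‖z‖ * ‖w‖ := mul_pos (norm_pos_iff.2 hz0) (norm_pos_iff.2 hw0)
  have hsin := norm_mul_norm_mul_sin_arg_sub z w
  intro heq
  have hr := Complex.arg_mem_Ioc (w / z)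
  rw [heq] at hr
  rcases lt_or_gt_of_ne hz with hz1 | hz1
  · have hw1 : 0 < w.im := by nlinarith
    have a := arg_mem_Ioo_of_im_neg hz1
    have b := arg_mem_Ioo_of_im_pos hw1
    have hs : 0 < Real.sin (z.arg - w.arg) := by
      by_contra! hcon
      nlinarith [mul_nonneg hpos.le (neg_nonneg.2 hcon)]
    have hs' : Real.sin (w.arg - z.arg) < 0 := by
      rw [← neg_sub, Real.sin_neg]
      linarith
    linarith [pi_lt_of_sin_neg (by linarith [a.2, b.1]) hs', hr.2]
  · have hw1 : w.im < 0 := by nlinarith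
    have a := arg_mem_Ioo_of_im_pos hz1
    have b := arg_mem_Ioo_of_im_neg hw1
    have hs : Real.sin (z.arg - w.arg) < 0 := by
      by_contra! hcon
      nlinarith [mul_nonneg hpos.le hcon]
    linarith [pi_lt_of_sin_neg (by linarith [a.1, b.2]) hs, hr.1]

/-- If exactly one edge of a polygon meets a vertical ray issuing from a point, then this point is
not in the exterior of the polygon. -/
theorem notMem_exterior_of_unique_crossing {m : ℕ} {p : Polygon Plane m} {r : Plane} {ε : ℝ}
    (hε : ε = 1 ∨ ε = -1) (hne : ∀ i, p i 0 ≠ r 0) (e : Fin m)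
    (he : CrossesRay ε r (p e) (p (finRotate m e)))
    (hav : ∀ i, i ≠ e → AvoidsRay ε r (p i) (p (finRotate m i))) : r ∉ polygonExterior p := by
  intro hr
  have hε2 : ε * ε = 1 := by rcases hε with h | h <;> simp [h]
  have hε0 : ε ≠ 0 := by rcases hε with h | h <;> simp [h]
  have hW := totalAngle_eq_zero_of_mem_exterior hr
  -- Multiplication by `ε * I` rotates the ray onto the negative real axis, the branch cut of `arg`.
  set z : Fin m → ℂ := fun i => ⟨-ε * (p i 1 - r 1), ε * (p i 0 - r 0)⟩ with hz
  have hzI : ∀ i, z i = ε * Complex.I * (toComplex (p i) - toComplex r) := by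
    intro i
    apply Complex.ext <;> simp [hz, toComplex]
  have hquot : ∀ i, (toComplex (p (finRotate m i)) - toComplex r) / (toComplex (p i) - toComplex r)
      = z (finRotate m i) / z i := by
    intro i
    rw [hzI, hzI, mul_div_mul_left]
    simp [hε0]
  have him : ∀ i, (z i).im ≠ 0 := fun i => mul_ne_zero hε0 (sub_ne_zero.2 (hne i))
  have key : ∀ a b a' b' : ℝ, (ε * a) * (ε * a') = a * a' ∧
      ((ε * a) * (-ε * b') - (-ε * b) * (ε * a')) * (ε * a) = ε * a * (b * a' - a * b') := by
    intro a b a' b'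
    constructor
    · linear_combination (a * a') * hε2
    · linear_combination (ε * a * (b * a' - a * b')) * hε2
  have hother : ∀ i, i ≠ e → (z (finRotate m i) / z i).arg - ((z (finRotate m i)).arg - (z i).arg)
      = 0 := by
    intro i hi
    rw [sub_eq_zero]
    apply arg_div_eq_sub_of_avoids (him _) (him _)
    simp only [hz]
    rw [(key _ (p i 1 - r 1) _ (p (finRotate m i) 1 - r 1)).1, (key _ _ _ _).2]
    exact hav i hi
  -- The differences of arguments telescope, so the total jump across the cut is the total angle,
  -- which is zero; yet only the edge `e` contributes a jump.
  have hsum : ∑ i, ((z (finRotate m i) / z i).arg - ((z (finRotate m i)).arg - (z i).arg)) = 0 := by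
    rw [Finset.sum_sub_distrib, sum_finRotate_sub_eq_zero (fun i => (z i).arg), sub_zero, ← hW]
    unfold totalAngle
    exact Finset.sum_congr rfl fun i _ => by rw [hquot]
  rw [Finset.sum_eq_single e (fun i _ hi => hother i hi) (by simp), sub_eq_zero] at hsum
  refine arg_div_ne_sub_of_crosses ?_ ?_ hsum
  · simp only [hz]
    rw [(key _ (p e 1 - r 1) _ (p (finRotate m e) 1 - r 1)).1]
    exact he.1
  · simp only [hz]
    rw [(key _ _ _ _).2]
    exact he.2

/-! ### Crossing segments and reversal of edges. -/

/-- Twice the signed area of a triangle. -/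
def orient (x y z : Plane) : ℝ :=
  (y 0 - x 0) * (z 1 - x 1) - (y 1 - x 1) * (z 0 - x 0)

theorem not_disjoint_affineSegment {x y a b : Plane} (h₁ : orient x y a * orient x y b < 0)
    (h₂ : orient a b x * orient a b y < 0) :
    ¬ Disjoint (affineSegment ℝ x y) (affineSegment ℝ a b) := by
  have hdiv : ∀ s t : ℝ, s * t < 0 → s - t ≠ 0 ∧ s / (s - t) ∈ Set.Icc (0 : ℝ) 1 := by
    intro s t hst
    rcases lt_trichotomy s 0 with hs | hs | hs
    · have ht : 0 < t := by nlinarith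
      refine ⟨by linarith, div_nonneg_of_nonpos hs.le (by linarith), ?_⟩
      rw [div_le_one_of_neg (by linarith)]
      linarith
    · simp [hs] at hst
    · have ht : t < 0 := by nlinarith
      refine ⟨by linarith, div_nonneg hs.le (by linarith), ?_⟩
      rw [div_le_one (by linarith)]
      linarith
  obtain ⟨n₁, i₁⟩ := hdiv _ _ h₁
  obtain ⟨n₂, i₂⟩ := hdiv _ _ h₂
  rw [Set.not_disjoint_iff]
  refine ⟨_, ⟨_, i₂, rfl⟩, ⟨_, i₁, ?_⟩⟩
  unfold orient at n₁ n₂ ⊢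
  ext i
  simp only [AffineMap.lineMap_apply, vsub_eq_sub, vadd_eq_add, PiLp.add_apply, PiLp.smul_apply,
    PiLp.sub_apply, smul_eq_mul]
  fin_cases i
  · simp only [Fin.zero_eta]
    field_simp
    ring
  · simp only [Fin.mk_one]
    field_simp
    ring

theorem AvoidsRay.symm {ε : ℝ} {r a b : Plane} (ha : a 0 ≠ r 0) (hb : b 0 ≠ r 0)
    (h : AvoidsRay ε r a b) : AvoidsRay ε r b a := by
  have ha' := sub_ne_zero.2 ha
  have hb' := sub_ne_zero.2 hb
  unfold AvoidsRay at h ⊢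
  generalize a 0 - r 0 = A at *
  generalize b 0 - r 0 = B at *
  generalize a 1 - r 1 = C at *
  generalize b 1 - r 1 = D at *
  rcases lt_or_gt_of_ne (mul_ne_zero ha' hb') with hAB | hAB
  · right
    have h := h.resolve_left hAB.not_gt
    have : 0 < (-(A * B)) * (ε * A * (C * B - A * D)) := mul_pos (by linarith) h
    have hA2 : 0 < A ^ 2 := by positivity
    by_contra! hcon
    nlinarith [mul_nonneg hA2.le (neg_nonneg.2 hcon)]
  · left
    linarith

theorem CrossesRay.symm {ε : ℝ} {r a b : Plane} (h : CrossesRay ε r a b) :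
    CrossesRay ε r b a := by
  unfold CrossesRay at h ⊢
  generalize a 0 - r 0 = A at *
  generalize b 0 - r 0 = B at *
  generalize a 1 - r 1 = C at *
  generalize b 1 - r 1 = D at *
  obtain ⟨hAB, h⟩ := h
  refine ⟨by linarith, ?_⟩
  have hA : A ≠ 0 := by rintro rfl; simp at hAB
  have : 0 < (A * B) * (ε * A * (C * B - A * D)) := mul_pos_of_neg_of_neg hAB h
  have hA2 : 0 < A ^ 2 := by positivity
  by_contra! hcon
  nlinarith [mul_nonneg hA2.le hcon]

/-! ### Colourings of a cycle. -/

section Cyclic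

variable {m : ℕ}

theorem finRotate_ne_self (hm : 3 ≤ m) (i : Fin m) : finRotate m i ≠ i := by
  obtain ⟨t, rfl⟩ := Nat.exists_eq_add_of_le' hm
  rw [finRotate_apply]
  intro h
  have h1 : (1 : Fin (t + 3)) = 0 := by simpa only [add_eq_left] using h
  simp at h1

theorem finRotate_finRotate_ne_self (hm : 3 ≤ m) (i : Fin m) :
    finRotate m (finRotate m i) ≠ i := by
  obtain ⟨t, rfl⟩ := Nat.exists_eq_add_of_le' hm
  rw [finRotate_apply, finRotate_apply, add_assoc]
  intro h
  have h1 : (1 : Fin (t + 3)) + 1 = 0 := by simpa using h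
  have h2 := congrArg Fin.val h1
  rw [Fin.val_add] at h2
  simp only [Fin.val_one, Fin.val_zero] at h2
  rw [Nat.mod_eq_of_lt (by omega)] at h2
  omega

open scoped Fin.NatCast Fin.CommRing in
/-- A function on a cycle that is constant along all edges having no end in common with a given edge
is constant off the ends of this edge. -/
theorem eq_of_forall_edge {α : Type*} (col : Fin m → α) (e : Fin m)
    (h : ∀ i, i ≠ e → i ≠ finRotate m e → e ≠ finRotate m i → col i = col (finRotate m i))
    {i j : Fin m} (hi : i ≠ e) (hi' : i ≠ finRotate m e) (hj : j ≠ e) (hj' : j ≠ finRotate m e) :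
    col i = col j := by
  obtain ⟨t, rfl⟩ : ∃ t, m = t + 1 := ⟨m - 1, by have := e.pos; omega⟩
  simp only [finRotate_apply] at h hi' hj'
  have cast_inj : ∀ a b : ℕ, a < t + 1 → b < t + 1 → ((a : ℕ) : Fin (t + 1)) = b → a = b := by
    intro a b ha hb hab
    have := congrArg Fin.val hab
    rwa [Fin.val_natCast, Fin.val_natCast, Nat.mod_eq_of_lt ha, Nat.mod_eq_of_lt hb] at this
  have hlast : ((t : ℕ) : Fin (t + 1)) + 1 = 0 := by simp
  have step : ∀ s : ℕ, s + 1 < t → col (e + 1 + ((s + 1 : ℕ) : Fin (t + 1))) = col (e + 1 + 1) := by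
    intro s
    induction s with
    | zero => intro _; simp
    | succ s ih =>
      intro hs
      rw [← ih (by omega), h (e + 1 + ((s + 1 : ℕ) : Fin (t + 1)))]
      · congr 1
        push_cast
        ring
      · intro h0
        have : ((s + 1 : ℕ) : Fin (t + 1)) = (t : ℕ) := by
          have h1 : 1 + ((s + 1 : ℕ) : Fin (t + 1)) = 0 := by simpa [add_assoc] using h0
          rw [← hlast] at h1
          exact add_right_cancel ((add_comm _ _).trans h1)
        have := cast_inj _ _ (by omega) (by omega) this
        omega
      · intro h0
        have : ((s + 1 : ℕ) : Fin (t + 1)) = ((0 : ℕ) : Fin (t + 1)) := by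
          simpa only [Nat.cast_zero, add_eq_left] using h0
        have := cast_inj _ _ (by omega) (by omega) this
        omega
      · intro h0
        have : ((s + 2 : ℕ) : Fin (t + 1)) = (t : ℕ) := by
          have h1 : ((s + 2 : ℕ) : Fin (t + 1)) + 1 = 0 := by
            have h2 : e + (((s + 2 : ℕ) : Fin (t + 1)) + 1) = e + 0 := by
              rw [add_zero]
              nth_rewrite 2 [h0]
              push_cast
              ring
            exact add_left_cancel h2
          rw [← hlast] at h1
          exact add_right_cancel h1
        have := cast_inj _ _ (by omega) (by omega) this
        omega
  have all : ∀ i, i ≠ e → i ≠ e + 1 → col i = col (e + 1 + 1) := by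
    intro i hi hi'
    -- Vertices are counted from `e + 1`: offset `0` is `e + 1` itself, offset `t` is `e`, and the
    -- offsets in between form the remaining path.
    have hrep : i = e + 1 + (((i - (e + 1)).val : ℕ) : Fin (t + 1)) := by simp
    have hlt := (i - (e + 1)).isLt
    have h0 : (i - (e + 1)).val ≠ 0 := by
      intro h0
      rw [h0] at hrep
      exact hi' (by simpa using hrep)
    have ht : (i - (e + 1)).val ≠ t := by
      intro h0
      rw [h0, add_assoc, add_comm 1, hlast, add_zero] at hrep
      exact hi hrep
    obtain ⟨s, hs⟩ := Nat.exists_eq_succ_of_ne_zero h0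
    rw [hrep, hs]
    exact step s (by omega)
  rw [all i hi hi', all j hj hj']

end Cyclic

/-! ### Chords of the parabola, the apex, and vertical rays. -/

/-- The point with abscissa `t` of the parabola `y = x ^ 2`. -/
noncomputable def parab (t : ℝ) : Plane := !₂[t, t ^ 2]

/-- The point at depth `w` below the origin. -/
noncomputable def apex (w : ℝ) : Plane := !₂[0, -w]

@[simp] theorem parab_zero_coord (t : ℝ) : parab t 0 = t := rfl
@[simp] theorem parab_one_coord (t : ℝ) : parab t 1 = t ^ 2 := rfl
@[simp] theorem apex_zero_coord (w : ℝ) : apex w 0 = 0 := rfl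
@[simp] theorem apex_one_coord (w : ℝ) : apex w 1 = -w := rfl

theorem parab_injective : Function.Injective parab := fun s t h => by
  simpa using congrArg (fun x : Plane => x 0) h

theorem parab_ne_apex {w : ℝ} (hw : 0 < w) (t : ℝ) : parab t ≠ apex w := fun h => by
  have h1 := congrArg (fun x : Plane => x 1) h
  simp only [parab_one_coord, apex_one_coord] at h1
  nlinarith [sq_nonneg t]

theorem not_disjoint_chords {a b x y : ℝ} (h : (x - a) * (x - b) * ((y - a) * (y - b)) < 0)
    (hab : a ≠ b) (hxy : x ≠ y) :
    ¬ Disjoint (affineSegment ℝ (parab a) (parab b)) (affineSegment ℝ (parab x) (parab y)) := by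
  have h₁ : 0 < (b - a) ^ 2 := by have := sub_ne_zero.2 hab.symm; positivity
  have h₂ : 0 < (y - x) ^ 2 := by have := sub_ne_zero.2 hxy.symm; positivity
  apply not_disjoint_affineSegment <;> simp only [orient, parab_zero_coord, parab_one_coord]
  · have := mul_neg_of_pos_of_neg h₁ h
    linarith
  · have := mul_neg_of_pos_of_neg h₂ h
    linarith

/-- The line through `apex w` and `parab j` meets the parabola again at abscissa `w / j < j`, and
`(t - j) * (t * j - w)` tells the side of `parab t`. So `b` lies strictly between `w / j` and `j`,
and `a` strictly outside; nonnegativity of `a` and `b` makes the chord meet the segment and not just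
its line. -/
theorem not_disjoint_apex_chord {w a b j : ℝ} (ha : 0 ≤ a) (hb : 0 ≤ b) (hj : 0 < j)
    (hw : w < j ^ 2) (h₁ : 0 < (a - j) * (a * j - w)) (h₂ : (b - j) * (b * j - w) < 0) :
    ¬ Disjoint (affineSegment ℝ (apex w) (parab j)) (affineSegment ℝ (parab a) (parab b)) := by
  have hbj : b < j ∧ w < b * j := by
    by_contra! hcon
    rcases lt_or_ge b j with h | h
    · nlinarith [hcon h]
    · have : 0 ≤ b * j - w := by nlinarith
      nlinarith
  have hab : a ≠ b := by rintro rfl; linarith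
  have h₃ : 0 < (b - a) ^ 2 := by have := sub_ne_zero.2 hab.symm; positivity
  apply not_disjoint_affineSegment <;>
    simp only [orient, parab_zero_coord, parab_one_coord, apex_zero_coord, apex_one_coord]
  · have := mul_neg_of_pos_of_neg h₁ h₂
    linarith
  · have h₄ : (j - a) * (j - b) * (a * b - w) < 0 := by
      rcases lt_or_ge j a with h | h
      · have : w < a * b := by nlinarith
        have : (j - a) * (j - b) < 0 := by nlinarith
        nlinarith
      · have h' : a * j < w := by nlinarith
        have h'' : a < j := lt_of_le_of_ne h (by rintro rfl; simp at h₁)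
        have : a * b < w := by nlinarith
        have : 0 < (j - a) * (j - b) := by nlinarith
        nlinarith
    have := mul_neg_of_pos_of_neg h₃ h₄
    linarith

section Rays

variable {w x a b : ℝ}

/-- By convexity chords run above the parabola. -/
theorem avoidsRay_down_chord (ha : a ≠ x) (hb : b ≠ x) :
    AvoidsRay (-1) (parab x) (parab a) (parab b) := by
  simp only [AvoidsRay, parab_zero_coord, parab_one_coord]
  have ha' := sub_ne_zero.2 ha
  have hb' := sub_ne_zero.2 hb
  rcases lt_or_gt_of_ne (mul_ne_zero ha' hb') with h | h
  · right
    have h₁ : 0 < (a - x) ^ 2 := by positivity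
    have h₂ : (b - x) * (a - b) < 0 := by nlinarith [sq_nonneg (b - x), sq_pos_of_ne_zero hb']
    have := mul_neg_of_pos_of_neg h₁ h₂
    linarith
  · exact Or.inl h

theorem avoidsRay_down_apex (hx : 0 < x) (ha : a < x) :
    AvoidsRay (-1) (parab x) (apex w) (parab a) := by
  left
  simp only [parab_zero_coord, apex_zero_coord]
  nlinarith

/-- The condition `x * a < w` says that at abscissa `x` the segment is below the parabola. -/
theorem crossesRay_down_apex (hx : 0 < x) (ha : x < a) (hw : x * a < w) :
    CrossesRay (-1) (parab x) (apex w) (parab a) := by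
  simp only [CrossesRay, parab_zero_coord, parab_one_coord, apex_zero_coord, apex_one_coord]
  refine ⟨by nlinarith, ?_⟩
  have := mul_pos (mul_pos hx (sub_pos.2 ha)) (sub_pos.2 hw)
  linarith

/-- The point with abscissa `1 / 2` and ordinate `y`. -/
noncomputable def halfPoint (y : ℝ) : Plane := !₂[1 / 2, y]

@[simp] theorem halfPoint_zero_coord (y : ℝ) : halfPoint y 0 = 1 / 2 := rfl
@[simp] theorem halfPoint_one_coord (y : ℝ) : halfPoint y 1 = y := rfl

variable {y : ℝ}

theorem avoidsRay_up_chord_right (ha : 1 ≤ a) (hb : 1 ≤ b) :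
    AvoidsRay 1 (halfPoint y) (parab a) (parab b) := by
  left
  simp only [parab_zero_coord, halfPoint_zero_coord]
  nlinarith

theorem avoidsRay_up_chord_zero (hb : 0 < b) (hy : b < 2 * y) :
    AvoidsRay 1 (halfPoint y) (parab 0) (parab b) := by
  right
  simp only [parab_zero_coord, parab_one_coord, halfPoint_zero_coord, halfPoint_one_coord]
  nlinarith

theorem crossesRay_up_chord_zero (hb : 1 ≤ b) (hy : 2 * y < b) :
    CrossesRay 1 (halfPoint y) (parab 0) (parab b) := by
  simp only [CrossesRay, parab_zero_coord, parab_one_coord, halfPoint_zero_coord,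
    halfPoint_one_coord]
  constructor <;> nlinarith

theorem avoidsRay_up_apex_zero : AvoidsRay 1 (halfPoint y) (apex w) (parab 0) := by
  left
  simp only [parab_zero_coord, apex_zero_coord, halfPoint_zero_coord]
  norm_num

theorem avoidsRay_up_apex (hw : 1 ≤ w) (hb : 1 ≤ b) (hy : b - 1 < 2 * y) :
    AvoidsRay 1 (halfPoint y) (apex w) (parab b) := by
  right
  simp only [parab_zero_coord, parab_one_coord, apex_zero_coord, apex_one_coord,
    halfPoint_zero_coord, halfPoint_one_coord]
  nlinarith [mul_pos (by linarith : 0 < b) (sub_pos.2 hy),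
    mul_nonneg (sub_nonneg.2 hw) (sub_nonneg.2 hb)]

end Rays

/-- Points of the parabola are in convex position, so chords with interleaved ends cross. The inner
equivalence encodes lying outside the interval spanned by `a` and `b`. -/
theorem same_side_of_disjoint {a b x y : ℕ} (hab : a ≠ b) (hxy : x ≠ y) (hxa : x ≠ a) (hxb : x ≠ b)
    (hya : y ≠ a) (hyb : y ≠ b)
    (hdis : Disjoint (affineSegment ℝ (parab a) (parab b)) (affineSegment ℝ (parab x) (parab y))) :
    (x < a ↔ x < b) ↔ (y < a ↔ y < b) := by
  have hsgn : ∀ z c : ℕ, z ≠ c → (z < c ∧ (z : ℝ) - c < 0) ∨ (¬ z < c ∧ 0 < (z : ℝ) - c) := by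
    intro z c hzc
    rcases lt_or_gt_of_ne hzc with h₃ | h₃
    · exact Or.inl ⟨h₃, sub_neg.2 (by exact_mod_cast h₃)⟩
    · exact Or.inr ⟨h₃.not_gt, sub_pos.2 (by exact_mod_cast h₃)⟩
  have hnn : ¬ ((x : ℝ) - a) * (x - b) * (((y : ℝ) - a) * (y - b)) < 0 := fun h₃ =>
    not_disjoint_chords h₃ (by exact_mod_cast hab) (by exact_mod_cast hxy) hdis
  rcases hsgn x a hxa with ⟨c₁, d₁⟩ | ⟨c₁, d₁⟩ <;> rcases hsgn x b hxb with ⟨c₂, d₂⟩ | ⟨c₂, d₂⟩ <;>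
  rcases hsgn y a hya with ⟨c₃, d₃⟩ | ⟨c₃, d₃⟩ <;> rcases hsgn y b hyb with ⟨c₄, d₄⟩ | ⟨c₄, d₄⟩ <;>
  simp only [c₁, c₂, c₃, c₄, iff_self, iff_true, iff_false,
    not_true_eq_false] <;> apply hnn
  · exact mul_neg_of_pos_of_neg (mul_pos_of_neg_of_neg d₁ d₂) (mul_neg_of_neg_of_pos d₃ d₄)
  · exact mul_neg_of_pos_of_neg (mul_pos_of_neg_of_neg d₁ d₂) (mul_neg_of_pos_of_neg d₃ d₄)
  · exact mul_neg_of_neg_of_pos (mul_neg_of_neg_of_pos d₁ d₂) (mul_pos_of_neg_of_neg d₃ d₄)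
  · exact mul_neg_of_neg_of_pos (mul_neg_of_neg_of_pos d₁ d₂) (mul_pos d₃ d₄)
  · exact mul_neg_of_neg_of_pos (mul_neg_of_pos_of_neg d₁ d₂) (mul_pos_of_neg_of_neg d₃ d₄)
  · exact mul_neg_of_neg_of_pos (mul_neg_of_pos_of_neg d₁ d₂) (mul_pos d₃ d₄)
  · exact mul_neg_of_pos_of_neg (mul_pos d₁ d₂) (mul_neg_of_neg_of_pos d₃ d₄)
  · exact mul_neg_of_pos_of_neg (mul_pos d₁ d₂) (mul_neg_of_pos_of_neg d₃ d₄)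

theorem same_side_of_consecutive {a b x y : ℕ} (hxy : x = y + 1 ∨ y = x + 1) (hxa : x ≠ a)
    (hxb : x ≠ b) (hya : y ≠ a) (hyb : y ≠ b) : (x < a ↔ x < b) ↔ (y < a ↔ y < b) := by
  have h₁ : x < a ↔ y < a := by omega
  have h₂ : x < b ↔ y < b := by omega
  rw [h₁, h₂]

theorem IsSimplePolygon.disjoint_edges {m : ℕ} {p : Polygon Plane m} (hp : IsSimplePolygon p)
    {i e : Fin m} (h₁ : i ≠ e) (h₂ : i ≠ finRotate m e) (h₃ : e ≠ finRotate m i) :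
    Disjoint (affineSegment ℝ (p e) (p (finRotate m e)))
      (affineSegment ℝ (p i) (p (finRotate m i))) :=
  hp.nonconsecutive e i h₁.symm h₂ h₃

/-! ### Combinatorics of a polygonization. -/

/-- A simple polygon one of whose vertices, with index `s`, is `apex w`, while the others are the
points of the parabola with abscissas `0, 1, …, N - 1`, the abscissa of the `i`-th vertex being
`J i`. -/
structure IsLabelled {m : ℕ} (p : Polygon Plane m) (w : ℝ) (N : ℕ) (s : Fin m) (J : Fin m → ℕ) :
    Prop where
  simple : IsSimplePolygon p
  apex_eq : p s = apex w
  parab_eq : ∀ i, i ≠ s → p i = parab (J i)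
  lt : ∀ i, i ≠ s → J i < N
  surj : ∀ j, j < N → ∃ i, i ≠ s ∧ J i = j

namespace IsLabelled

variable {m : ℕ} {p : Polygon Plane m} {w : ℝ} {N k : ℕ} {s : Fin m} {J : Fin m → ℕ}

theorem eq_of_label_eq (h : IsLabelled p w N s J) {i j : Fin m} (hi : i ≠ s) (hj : j ≠ s)
    (hij : J i = J j) : i = j :=
  h.simple.injective (by rw [h.parab_eq i hi, h.parab_eq j hj, hij])

theorem next_ne (h : IsLabelled p w N s J) (i : Fin m) : finRotate m i ≠ i :=
  finRotate_ne_self h.simple.three_le i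

theorem next_next_ne (h : IsLabelled p w N s J) (i : Fin m) :
    finRotate m (finRotate m i) ≠ i :=
  finRotate_finRotate_ne_self h.simple.three_le i

/-- The neighbours of the apex have small labels, since a chord of the convex hull that separates
two vertices is not an edge. -/
theorem label_le_of_adjacent_apex (h : IsLabelled p w N s J)
    (hw₁ : ((k + 1) ^ 2 : ℝ) < w) (hw₂ : w < (k + 1) ^ 2 + 1 / 2)
    (hwJ : ∀ a b : ℕ, (a * b : ℝ) ≠ w) {e i : Fin m} (hi : i ≠ s)
    (he : (e = s ∧ finRotate m e = i) ∨ (e = i ∧ finRotate m e = s)) : J i ≤ k + 1 := by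
  by_contra! hk
  have hiN := h.lt i hi
  have hkj : ((k : ℝ) + 2) ≤ J i := by exact_mod_cast hk
  set j : ℝ := ((J i : ℕ) : ℝ) with hj
  have hk0 : (0 : ℝ) ≤ k := Nat.cast_nonneg k
  have hwj : w < j ^ 2 := by nlinarith
  have hseg : affineSegment ℝ (p e) (p (finRotate m e)) = affineSegment ℝ (apex w) (parab j) := by
    rcases he with ⟨h₁, h₂⟩ | ⟨h₁, h₂⟩
    · rw [h₂, h₁, h.apex_eq, h.parab_eq i hi]
    · rw [h₂, h₁, h.apex_eq, h.parab_eq i hi, affineSegment_comm]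
  have hends : ∀ x, x ≠ e → x ≠ finRotate m e → x ≠ s ∧ x ≠ i := by
    intro x h₁ h₂
    rcases he with ⟨h₃, h₄⟩ | ⟨h₃, h₄⟩
    · rw [h₃] at h₁; rw [h₄] at h₂; exact ⟨h₁, h₂⟩
    · rw [h₃] at h₁; rw [h₄] at h₂; exact ⟨h₂, h₁⟩
  have hends' : ∀ x, x ≠ s → x ≠ i → x ≠ e ∧ x ≠ finRotate m e := by
    intro x h₁ h₂
    rcases he with ⟨h₃, h₄⟩ | ⟨h₃, h₄⟩
    · rw [h₃, ← h₃, h₄, h₃]; exact ⟨h₁, h₂⟩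
    · rw [h₄, h₃]; exact ⟨h₂, h₁⟩
  have hsign : ∀ x, x ≠ s → x ≠ i → ((J x : ℝ) - j) * (J x * j - w) ≠ 0 := by
    intro x h₁ h₂
    refine mul_ne_zero (sub_ne_zero.2 fun h₃ => h₂ (h.eq_of_label_eq h₁ hi ?_))
      (sub_ne_zero.2 (hwJ _ _))
    exact Nat.cast_injective (R := ℝ) h₃
  -- Edges sharing no end with `e` cannot cross it, so the side of the line through `e` is constant
  -- along the rest of the cycle.
  have hcol := fun x y => eq_of_forall_edge (i := x) (j := y)
    (fun x => (0 < ((J x : ℝ) - j) * (J x * j - w))) e (by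
    intro x h₁ h₂ h₃
    obtain ⟨a₁, a₂⟩ := hends x h₁ h₂
    obtain ⟨b₁, b₂⟩ := hends (finRotate m x) (fun h₄ => h₃ h₄.symm)
      (fun h₄ => h₁ ((finRotate m).injective h₄))
    have hdis := h.simple.disjoint_edges h₁ h₂ h₃
    rw [hseg, h.parab_eq x a₁, h.parab_eq _ b₁] at hdis
    rcases lt_or_gt_of_ne (hsign x a₁ a₂) with c | c <;>
      rcases lt_or_gt_of_ne (hsign _ b₁ b₂) with d | d
    · simp only [c.not_gt, d.not_gt]
    · rw [affineSegment_comm ℝ (parab (J x))] at hdis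
      exact absurd hdis (not_disjoint_apex_chord (Nat.cast_nonneg _) (Nat.cast_nonneg _)
        (by linarith) hwj d c)
    · exact absurd hdis (not_disjoint_apex_chord (Nat.cast_nonneg _) (Nat.cast_nonneg _)
        (by linarith) hwj c d)
    · simp only [c, d])
  obtain ⟨x, hx, hx0⟩ := h.surj 0 (by omega)
  obtain ⟨y, hy, hyk⟩ := h.surj (k + 1) (by omega)
  have hxi : x ≠ i := by rintro rfl; omega
  have hyi : y ≠ i := by rintro rfl; omega
  obtain ⟨x₁, x₂⟩ := hends' x hx hxi
  obtain ⟨y₁, y₂⟩ := hends' y hy hyi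
  have := hcol x y x₁ x₂ y₁ y₂
  rw [hx0, hyk] at this
  push_cast at this
  -- Labels `0` and `k + 1` are on opposite sides, since `w < (k + 1) * (k + 2) ≤ (k + 1) * j`.
  have hneg : ((k : ℝ) + 1 - j) * ((k + 1) * j - w) < 0 := by
    apply mul_neg_of_neg_of_pos <;> nlinarith
  have hpos : 0 < (0 - j) * (0 * j - w) := by nlinarith
  rw [eq_iff_iff] at this
  linarith [this.1 hpos]

/-- An excluded point of the parabola with abscissa between `j` and `j + 1` is not separated from
the rest by the two edges at the apex. -/
theorem not_separated (h : IsLabelled p w N s J) {j : ℕ} {x : ℝ} (hx₁ : (j : ℝ) < x)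
    (hx₂ : x < j + 1) (hr : parab x ∈ polygonExterior p) {i i' e : Fin m} (hi : i ≠ s)
    (hi' : i' ≠ s)
    (he : (e = s ∧ finRotate m e = i) ∨ (e = i ∧ finRotate m e = s))
    (hs : ∀ f, f ≠ e → (f = s ∨ finRotate m f = s) →
      (f = s ∧ finRotate m f = i') ∨ (f = i' ∧ finRotate m f = s))
    (hw : x * J i < w) (hij : j < J i) (hij' : J i' ≤ j) : False := by
  have hx : 0 < x := lt_of_le_of_lt (Nat.cast_nonneg j) hx₁
  have hnat : ∀ n : ℕ, (n : ℝ) ≠ x := by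
    intro n hn
    rw [← hn] at hx₁ hx₂
    have h₁ : j < n := by exact_mod_cast hx₁
    have h₂ : n < j + 1 := by exact_mod_cast hx₂
    omega
  have hxi : x < J i := hx₂.trans_le (by exact_mod_cast hij)
  have hxi' : (J i' : ℝ) < x := lt_of_le_of_lt (by exact_mod_cast hij') hx₁
  refine notMem_exterior_of_unique_crossing (Or.inr rfl) ?_ e ?_ ?_ hr
  · intro f
    by_cases hf : f = s
    · rw [hf, h.apex_eq]
      simpa using hx.ne
    · rw [h.parab_eq f hf]
      exact hnat _
  · rcases he with ⟨h₁, h₂⟩ | ⟨h₁, h₂⟩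
    · rw [h₂, h₁, h.apex_eq, h.parab_eq i hi]
      exact crossesRay_down_apex hx hxi hw
    · rw [h₂, h₁, h.apex_eq, h.parab_eq i hi]
      exact (crossesRay_down_apex hx hxi hw).symm
  · intro f hf
    by_cases hfs : f = s ∨ finRotate m f = s
    · rcases hs f hf hfs with ⟨h₁, h₂⟩ | ⟨h₁, h₂⟩
      · rw [h₂, h₁, h.apex_eq, h.parab_eq i' hi']
        exact avoidsRay_down_apex hx hxi'
      · rw [h₂, h₁, h.apex_eq, h.parab_eq i' hi']
        exact (avoidsRay_down_apex hx hxi').symm hx.ne (hnat _)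
    · push Not at hfs
      rw [h.parab_eq f hfs.1, h.parab_eq _ hfs.2]
      exact avoidsRay_down_chord (hnat _) (hnat _)

/-- The point just below the longest chord is not excluded if this chord is an edge. -/
theorem not_long_edge (h : IsLabelled p w N s J) (hN : 2 ≤ N) (hw : 1 ≤ w) {y : ℝ}
    (hy₁ : (N : ℝ) - 2 < 2 * y) (hy₂ : 2 * y < N - 1) (hr : halfPoint y ∈ polygonExterior p)
    {e : Fin m} (he : e ≠ s) (he' : finRotate m e ≠ s) :
    ¬ (J e = 0 ∧ J (finRotate m e) = N - 1) ∧ ¬ (J e = N - 1 ∧ J (finRotate m e) = 0) := by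
  have hhalf : ∀ n : ℕ, (n : ℝ) ≠ 1 / 2 := by
    intro n hn
    have : ((2 * n : ℕ) : ℝ) = (1 : ℕ) := by push_cast; linarith
    have := Nat.cast_injective this
    omega
  have hcast : ((N - 1 : ℕ) : ℝ) = N - 1 := by
    rw [Nat.cast_sub (by omega), Nat.cast_one]
  have hN' : (2 : ℝ) ≤ N := by exact_mod_cast hN
  have hcross := crossesRay_up_chord_zero (b := ((N - 1 : ℕ) : ℝ)) (y := y)
    (by rw [hcast]; linarith) (by rw [hcast]; exact hy₂)
  -- At abscissa `1 / 2` the edges from the apex, like the shorter chords from `0`, pass below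
  -- height `y`.
  have hapex : ∀ n : ℕ, n < N → AvoidsRay 1 (halfPoint y) (apex w) (parab n) := by
    intro n hn
    rcases Nat.eq_zero_or_pos n with h₀ | h₀
    · rw [h₀, Nat.cast_zero]
      exact avoidsRay_up_apex_zero
    · apply avoidsRay_up_apex hw (by exact_mod_cast h₀)
      have : (n : ℝ) + 1 ≤ N := by exact_mod_cast hn
      linarith
  have hchord : ∀ a b : ℕ, a < N → b < N → a ≠ b → ¬ (a = 0 ∧ b = N - 1) → ¬ (a = N - 1 ∧ b = 0) →
      AvoidsRay 1 (halfPoint y) (parab a) (parab b) := by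
    have hzero : ∀ b : ℕ, 0 < b → b < N → b ≠ N - 1 →
        AvoidsRay 1 (halfPoint y) (parab (0 : ℕ)) (parab b) := by
      intro b hb hbN hb'
      rw [Nat.cast_zero]
      apply avoidsRay_up_chord_zero (by exact_mod_cast hb)
      have : (b : ℝ) + 2 ≤ N := by exact_mod_cast (by omega : b + 2 ≤ N)
      linarith
    intro a b ha hb hab h₁ h₂
    rcases Nat.eq_zero_or_pos a with h₃ | h₃
    · subst h₃
      exact hzero b (by omega) hb (by tauto)
    · rcases Nat.eq_zero_or_pos b with h₄ | h₄
      · subst h₄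
        exact (hzero a h₃ ha (by tauto)).symm (hhalf _) (hhalf _)
      · exact avoidsRay_up_chord_right (by exact_mod_cast h₃) (by exact_mod_cast h₄)
  have main : CrossesRay 1 (halfPoint y) (p e) (p (finRotate m e)) →
      (∀ f, f ≠ e → f ≠ s → finRotate m f ≠ s →
        ¬ (J f = 0 ∧ J (finRotate m f) = N - 1) ∧ ¬ (J f = N - 1 ∧ J (finRotate m f) = 0)) →
      False := by
    intro hc hf
    refine notMem_exterior_of_unique_crossing (Or.inl rfl) ?_ e hc ?_ hr
    · intro f
      by_cases hfs : f = s
      · rw [hfs, h.apex_eq]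
        simp
      · rw [h.parab_eq f hfs]
        exact hhalf _
    · intro f hfe
      by_cases h₁ : f = s
      · have h₂ : finRotate m f ≠ s := by rw [← h₁]; exact h.next_ne f
        rw [h₁, h.apex_eq, ← h₁, h.parab_eq _ h₂]
        exact hapex _ (h.lt _ h₂)
      by_cases h₂ : finRotate m f = s
      · rw [h₂, h.apex_eq, h.parab_eq f h₁]
        exact (hapex _ (h.lt _ h₁)).symm (by simp) (hhalf _)
      rw [h.parab_eq f h₁, h.parab_eq _ h₂]
      exact hchord _ _ (h.lt _ h₁) (h.lt _ h₂)
        (fun h₃ => h.next_ne f (h.eq_of_label_eq h₂ h₁ h₃.symm)) (hf f hfe h₁ h₂).1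
        (hf f hfe h₁ h₂).2
  refine ⟨fun ⟨h₁, h₂⟩ => main ?_ ?_, fun ⟨h₁, h₂⟩ => main ?_ ?_⟩
  · rw [h.parab_eq e he, h.parab_eq _ he', h₁, h₂, Nat.cast_zero]
    exact hcross
  · intro f hfe hf hf'
    refine ⟨fun ⟨h₃, h₄⟩ => hfe (h.eq_of_label_eq hf he (h₃.trans h₁.symm)), fun ⟨h₃, h₄⟩ => ?_⟩
    have h₅ := h.eq_of_label_eq hf he' (h₃.trans h₂.symm)
    have h₆ := h.eq_of_label_eq hf' he (h₄.trans h₁.symm)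
    rw [h₅] at h₆
    exact h.next_next_ne e h₆
  · rw [h.parab_eq e he, h.parab_eq _ he', h₁, h₂, Nat.cast_zero]
    exact hcross.symm
  · intro f hfe hf hf'
    refine ⟨fun ⟨h₃, h₄⟩ => ?_, fun ⟨h₃, h₄⟩ => hfe (h.eq_of_label_eq hf he (h₃.trans h₁.symm))⟩
    have h₅ := h.eq_of_label_eq hf he' (h₃.trans h₂.symm)
    have h₆ := h.eq_of_label_eq hf' he (h₄.trans h₁.symm)
    rw [h₅] at h₆
    exact h.next_next_ne e h₆

/-- If the neighbours of the apex are consecutive on the parabola, then every edge not containing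
the apex is an edge of the convex hull of the points on the parabola. -/
theorem succ_or_long (h : IsLabelled p w N s J) {i₁ i₂ : Fin m} (h₁ : finRotate m s = i₁)
    (h₂ : finRotate m i₂ = s) (hc : J i₁ = J i₂ + 1 ∨ J i₂ = J i₁ + 1) {e : Fin m} (he : e ≠ s)
    (he' : finRotate m e ≠ s) :
    J (finRotate m e) = J e + 1 ∨ J e = J (finRotate m e) + 1 ∨
      (J e = 0 ∧ J (finRotate m e) = N - 1) ∨ (J e = N - 1 ∧ J (finRotate m e) = 0) := by
  have hi₁ : i₁ ≠ s := by rw [← h₁]; exact h.next_ne s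
  have hi₂ : i₂ ≠ s := by rintro rfl; exact h.next_ne _ h₂
  set a := J e with ha
  set b := J (finRotate m e) with hb
  have hab : a ≠ b := fun h₀ => h.next_ne e (h.eq_of_label_eq he' he h₀.symm)
  have hlab : ∀ i, i ≠ s → (i ≠ e → J i ≠ a) ∧ (i ≠ finRotate m e → J i ≠ b) := fun i hi =>
    ⟨fun h₃ h₄ => h₃ (h.eq_of_label_eq hi he h₄), fun h₃ h₄ => h₃ (h.eq_of_label_eq hi he' h₄)⟩
  let side : ℕ → Prop := fun x => (x < a ↔ x < b)
  classical
  -- The apex gets the side of a neighbour that is not an end of `e`, when there is one. If neither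
  -- neighbour is an end, the choice is immaterial, as consecutive labels lie on the same side.
  let col : Fin m → Prop := fun i =>
    if i = s then (if i₁ = e ∨ i₁ = finRotate m e then side (J i₂) else side (J i₁))
    else side (J i)
  have hcol : ∀ x y, x ≠ s → y ≠ s → x ≠ e → x ≠ finRotate m e → y ≠ e → y ≠ finRotate m e →
      side (J x) = side (J y) := by
    intro x y hx hy hxe hxe' hye hye'
    have := eq_of_forall_edge col e (by
      intro i hi hi' hi''
      have hn : finRotate m i ≠ finRotate m e := fun h₄ => hi ((finRotate m).injective h₄)
      by_cases c₁ : i = s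
      · have c₂ : finRotate m i ≠ s := by rw [c₁, h₁]; exact hi₁
        have c₃ : ¬ (i₁ = e ∨ i₁ = finRotate m e) := by
          rw [← h₁, ← c₁]
          rintro (h₃ | h₃)
          · exact hi'' h₃.symm
          · exact hn h₃
        simp only [col, if_pos c₁, if_neg c₂, if_neg c₃]
        rw [c₁, h₁]
      by_cases c₂ : finRotate m i = s
      · have c₃ : i = i₂ := (finRotate m).injective (c₂.trans h₂.symm)
        simp only [col, if_neg c₁, if_pos c₂]
        rw [c₃]
        split_ifs with c₄
        · rfl
        · push Not at c₄
          rw [c₃] at hi hi'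
          exact propext (same_side_of_consecutive hc.symm ((hlab i₂ hi₂).1 hi)
            ((hlab i₂ hi₂).2 hi') ((hlab i₁ hi₁).1 c₄.1) ((hlab i₁ hi₁).2 c₄.2))
      · have hdis := h.simple.disjoint_edges hi hi' hi''
        rw [h.parab_eq e he, h.parab_eq _ he', h.parab_eq i c₁, h.parab_eq _ c₂] at hdis
        simp only [col, if_neg c₁, if_neg c₂]
        exact propext <| same_side_of_disjoint hab
          (fun h₃ => h.next_ne i (h.eq_of_label_eq c₂ c₁ h₃.symm))
          ((hlab i c₁).1 hi) ((hlab i c₁).2 hi') ((hlab _ c₂).1 hi''.symm) ((hlab _ c₂).2 hn) hdis)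
      hxe hxe' hye hye'
    simpa only [col, if_neg hx, if_neg hy] using this
  have haN : a < N := h.lt e he
  have hbN : b < N := h.lt _ he'
  have hnat : ∀ x y, x < N → y < N → x ≠ a → x ≠ b → y ≠ a → y ≠ b → side x = side y := by
    intro x y hx hy hxa hxb hya hyb
    obtain ⟨i, hi, rfl⟩ := h.surj x hx
    obtain ⟨j, hj, rfl⟩ := h.surj y hy
    exact hcol i j hi hj (fun h₃ => hxa (by rw [h₃])) (fun h₃ => hxb (by rw [h₃]))
      (fun h₃ => hya (by rw [h₃])) (fun h₃ => hyb (by rw [h₃]))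
  simp only [side, eq_iff_iff] at hnat
  -- Otherwise some label lies strictly between `a` and `b` and another strictly outside,
  -- contradicting the constancy of `side`.
  by_contra! hcon
  have hmid : ∃ x, min a b < x ∧ x < max a b := ⟨min a b + 1, by omega, by omega⟩
  obtain ⟨x, hx₁, hx₂⟩ := hmid
  have hout : ∃ y, y < N ∧ (y < min a b ∨ max a b < y) := by
    rcases Nat.eq_zero_or_pos (min a b) with h₃ | h₃
    · exact ⟨N - 1, by omega, by omega⟩
    · exact ⟨0, by omega, by omega⟩
  obtain ⟨y, hy₁, hy₂⟩ := hout
  have := hnat x y (by omega) hy₁ (by omega) (by omega) (by omega) (by omega)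
  omega

/-- The labelled polygon does not exclude the point below the longest chord and all the points of
the parabola with abscissas `j + 1 / 2` where `j ≤ k` is odd. -/
theorem not_excluding (h : IsLabelled p w N s J) (hN : 2 ≤ N)
    (hw₁ : ((k + 1) ^ 2 : ℝ) < w) (hw₂ : w < (k + 1) ^ 2 + 1 / 2)
    (hwJ : ∀ a b : ℕ, (a * b : ℝ) ≠ w) {y : ℝ} (hy₁ : (N : ℝ) - 2 < 2 * y) (hy₂ : 2 * y < N - 1)
    (hr : halfPoint y ∈ polygonExterior p)
    (hrs : ∀ j : ℕ, Odd j → j ≤ k → parab (j + 1 / 2) ∈ polygonExterior p) : False := by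
  obtain ⟨i₂, h₂⟩ := (finRotate m).surjective s
  obtain ⟨i₁, h₁⟩ : ∃ i₁, finRotate m s = i₁ := ⟨_, rfl⟩
  have hi₁ : i₁ ≠ s := by rw [← h₁]; exact h.next_ne s
  have hi₂ : i₂ ≠ s := by rintro rfl; exact h.next_ne _ h₂
  have h₁₂ : i₁ ≠ i₂ := by rintro rfl; exact h.next_next_ne s (by rw [h₁, h₂])
  have hk₁ := h.label_le_of_adjacent_apex hw₁ hw₂ hwJ hi₁ (Or.inl ⟨rfl, h₁⟩)
  have hk₂ := h.label_le_of_adjacent_apex hw₁ hw₂ hwJ hi₂ (Or.inr ⟨rfl, h₂⟩)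
  have hJ₁₂ : J i₁ ≠ J i₂ := fun h₀ => h₁₂ (h.eq_of_label_eq hi₁ hi₂ h₀)
  have hk0 : (0 : ℝ) ≤ k := Nat.cast_nonneg k
  have hwx : ∀ j n : ℕ, j ≤ k → n ≤ k + 1 → ((j : ℝ) + 1 / 2) * n < w := by
    intro j n hj hn
    have hj' : (j : ℝ) ≤ k := by exact_mod_cast hj
    have hn' : (n : ℝ) ≤ k + 1 := by exact_mod_cast hn
    have : ((j : ℝ) + 1 / 2) * n ≤ (k + 1) * (k + 1) :=
      mul_le_mul (by linarith) hn' (Nat.cast_nonneg n) (by linarith)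
    nlinarith
  have hsep : ∀ j, Odd j → j ≤ k → ¬ (J i₂ ≤ j ∧ j < J i₁) ∧ ¬ (J i₁ ≤ j ∧ j < J i₂) := by
    intro j hj hjk
    refine ⟨fun ⟨h₃, h₄⟩ => ?_, fun ⟨h₃, h₄⟩ => ?_⟩
    · refine h.not_separated (by linarith) (by linarith) (hrs j hj hjk) hi₁ hi₂
        (Or.inl ⟨rfl, h₁⟩) ?_ (hwx j _ hjk hk₁) h₄ h₃
      rintro f hf (hf' | hf')
      · exact absurd hf' hf
      · exact Or.inr ⟨(finRotate m).injective (hf'.trans h₂.symm), hf'⟩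
    · refine h.not_separated (by linarith) (by linarith) (hrs j hj hjk) hi₂ hi₁
        (Or.inr ⟨rfl, h₂⟩) ?_ (hwx j _ hjk hk₂) h₄ h₃
      rintro f hf (hf' | hf')
      · exact Or.inl ⟨hf', by rw [hf', h₁]⟩
      · exact absurd ((finRotate m).injective (hf'.trans h₂.symm)) hf
  -- If the labels differ by at least two, one of the smaller label and its successor is an odd `j ≤
  -- k`, and the red point at `j + 1 / 2` separates them.
  have hconsec : J i₁ = J i₂ + 1 ∨ J i₂ = J i₁ + 1 := by
    by_contra! hcon
    rcases lt_or_gt_of_ne hJ₁₂ with h₃ | h₃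
    · rcases Nat.even_or_odd (J i₁) with h₄ | h₄
      · exact (hsep (J i₁ + 1) h₄.add_one (by omega)).2 ⟨by omega, by omega⟩
      · exact (hsep (J i₁) h₄ (by omega)).2 ⟨by omega, by omega⟩
    · rcases Nat.even_or_odd (J i₂) with h₄ | h₄
      · exact (hsep (J i₂ + 1) h₄.add_one (by omega)).1 ⟨by omega, by omega⟩
      · exact (hsep (J i₂) h₄ (by omega)).1 ⟨by omega, by omega⟩
  have hedge : ∀ e, e ≠ s → finRotate m e ≠ s →
      (J (finRotate m e) = J e + 1 ∨ J e = J (finRotate m e) + 1) ∧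
      ¬ (J e = 0 ∧ J (finRotate m e) = N - 1) ∧ ¬ (J e = N - 1 ∧ J (finRotate m e) = 0) := by
    intro e he he'
    have h₃ := h.not_long_edge hN (by nlinarith) hy₁ hy₂ hr he he'
    have h₄ := h.succ_or_long h₁ h₂ hconsec he he'
    tauto
  -- Away from the apex, both neighbours of an extreme label would carry the single adjacent label,
  -- hence coincide.
  have hextreme : ∀ i, i ≠ s → J i = 0 ∨ J i = N - 1 → i = i₁ ∨ i = i₂ := by
    intro i hi hJ
    by_contra! hcon
    obtain ⟨i', hi'⟩ := (finRotate m).surjective i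
    have c₁ : finRotate m i ≠ s := fun h₀ => hcon.2 ((finRotate m).injective (h₀.trans h₂.symm))
    have c₂ : i' ≠ s := by rintro rfl; exact hcon.1 (hi'.symm.trans h₁)
    have e₁ := hedge i hi c₁
    have e₂ := hedge i' c₂ (by rw [hi']; exact hi)
    rw [hi'] at e₂
    have l₁ := h.lt _ c₁
    have l₂ := h.lt _ c₂
    have : finRotate m i = i' := h.eq_of_label_eq c₁ c₂ (by omega)
    exact h.next_next_ne i' (by rw [hi', this])
  obtain ⟨x, hx, hx0⟩ := h.surj 0 (by omega)
  obtain ⟨z, hz, hzN⟩ := h.surj (N - 1) (by omega)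
  have hN2 : N = 2 := by
    rcases hextreme x hx (Or.inl hx0) with rfl | rfl <;>
      rcases hextreme z hz (Or.inr hzN) with rfl | rfl <;> omega
  subst hN2
  rcases hextreme x hx (Or.inl hx0) with h₃ | h₃
  · have c : finRotate m x ≠ s := by rw [h₃, ← h₁]; exact h.next_next_ne s
    have e₁ := hedge x hx c
    have l := h.lt _ c
    omega
  · obtain ⟨x', hx'⟩ := (finRotate m).surjective x
    have c : x' ≠ s := by
      rintro rfl
      exact h.next_next_ne x' (by rw [hx', h₃, h₂])
    have e₁ := hedge x' c (by rw [hx']; exact hx)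
    rw [hx'] at e₁
    have l := h.lt _ c
    omega

end IsLabelled

/-! ### General position. -/

theorem orient_eq_zero_of_collinear {a b c : Plane} (h : Collinear ℝ {a, b, c}) :
    orient a b c = 0 := by
  rw [collinear_iff_of_mem (p₀ := a) (by simp)] at h
  obtain ⟨v, hv⟩ := h
  obtain ⟨r, hr⟩ := hv b (by simp)
  obtain ⟨t, ht⟩ := hv c (by simp)
  rw [hr, ht]
  simp only [orient, vadd_eq_add, PiLp.add_apply, PiLp.smul_apply, smul_eq_mul]
  ring

theorem GeneralPosition.mono {S T : Set Plane} (hT : GeneralPosition T) (h : S ⊆ T) :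
    GeneralPosition S :=
  fun a ha b hb c hc => hT a (h ha) b (h hb) c (h hc)

/-- An irrational apex, an irrational point on the line `x = 1 / 2`, and the points of the parabola
with rational abscissas are in general position. -/
theorem generalPosition_union {w y : ℝ} (hw : ∀ q : ℚ, (q : ℝ) ≠ w) (hy : ∀ q : ℚ, (q : ℝ) ≠ y)
    {c : ℚ} (hwy : y + w = c) :
    GeneralPosition ({apex w, halfPoint y} ∪ Set.range fun q : ℚ => parab q) := by
  have hPPP : ∀ s t u : ℚ, parab s ≠ parab t → parab s ≠ parab u → parab t ≠ parab u →
      orient (parab s) (parab t) (parab u) ≠ 0 := by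
    intro s t u h₁ h₂ h₃ h
    have e : ((t : ℝ) - s) * ((u - s) * (u - t)) = 0 := by
      rw [← h]
      simp only [orient, parab_zero_coord, parab_one_coord]
      ring
    rcases mul_eq_zero.1 e with h | h
    · exact h₁ (by rw [sub_eq_zero.1 h])
    rcases mul_eq_zero.1 h with h | h
    · exact h₂ (by rw [sub_eq_zero.1 h])
    · exact h₃ (by rw [sub_eq_zero.1 h])
  have hAPP : ∀ s t : ℚ, parab s ≠ parab t → orient (apex w) (parab s) (parab t) ≠ 0 := by
    intro s t h₁ h
    have e : ((t : ℝ) - s) * (s * t - w) = 0 := by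
      rw [← h]
      simp only [orient, parab_zero_coord, parab_one_coord, apex_zero_coord, apex_one_coord]
      ring
    rcases mul_eq_zero.1 e with h | h
    · exact h₁ (by rw [sub_eq_zero.1 h])
    · exact hw (s * t) (by push_cast; linarith)
  have hHPP : ∀ s t : ℚ, parab s ≠ parab t → orient (halfPoint y) (parab s) (parab t) ≠ 0 := by
    intro s t h₁ h
    have e : ((t : ℝ) - s) * (s * t - s / 2 - t / 2 + y) = 0 := by
      rw [← h]
      simp only [orient, parab_zero_coord, parab_one_coord, halfPoint_zero_coord,
        halfPoint_one_coord]
      ring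
    rcases mul_eq_zero.1 e with h | h
    · exact h₁ (by rw [sub_eq_zero.1 h])
    · exact hy (s / 2 + t / 2 - s * t) (by push_cast; linarith)
  have hAHP : ∀ t : ℚ, orient (apex w) (halfPoint y) (parab t) ≠ 0 := by
    intro t h
    simp only [orient, parab_zero_coord, parab_one_coord, apex_zero_coord, apex_one_coord,
      halfPoint_zero_coord, halfPoint_one_coord] at h
    -- Rationality of `y + w` makes this collinearity a rational equation for `w`.
    refine hw (2 * c * t - t ^ 2) ?_
    push_cast
    rw [← hwy]
    linarith
  intro a ha b hb c hc hab hac hbc hcol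
  have h := orient_eq_zero_of_collinear hcol
  clear hcol
  rcases ha with (rfl | rfl) | ⟨s, rfl⟩ <;> rcases hb with (rfl | rfl) | ⟨t, rfl⟩ <;>
    rcases hc with (rfl | rfl) | ⟨u, rfl⟩ <;>
    first
    | exact hab rfl
    | exact hac rfl
    | exact hbc rfl
    | exact hPPP _ _ _ hab hac hbc h
    | exact hAPP _ _ hab (by unfold orient at h ⊢; linear_combination h)
    | exact hAPP _ _ hac (by unfold orient at h ⊢; linear_combination -h)
    | exact hAPP _ _ hbc (by unfold orient at h ⊢; linear_combination h)
    | exact hHPP _ _ hab (by unfold orient at h ⊢; linear_combination h)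
    | exact hHPP _ _ hac (by unfold orient at h ⊢; linear_combination -h)
    | exact hHPP _ _ hbc (by unfold orient at h ⊢; linear_combination h)
    | exact hAHP _ (by unfold orient at h ⊢; linear_combination h)
    | exact hAHP _ (by unfold orient at h ⊢; linear_combination -h)

/-! ### Vertices and interior of the blue hull. -/

/-- A point at which a linear functional attains a strict maximum over a set is a vertex of the
convex hull of this set. -/
theorem mem_hullVertices_of_strict_max {S : Set Plane} {x : Plane} (hx : x ∈ S) (α β : ℝ)
    (h : ∀ z ∈ S, z ≠ x → α * z 0 + β * z 1 < α * x 0 + β * x 1) : x ∈ hullVertices S := by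
  have hconv : Convex ℝ {z : Plane | z = x ∨ α * z 0 + β * z 1 < α * x 0 + β * x 1} := by
    rw [convex_iff_forall_pos]
    rintro u hu v hv a b ha hb hab
    have hu' : α * u 0 + β * u 1 ≤ α * x 0 + β * x 1 := by
      rcases hu with rfl | hu
      · exact le_rfl
      · exact hu.le
    have hv' : α * v 0 + β * v 1 ≤ α * x 0 + β * x 1 := by
      rcases hv with rfl | hv
      · exact le_rfl
      · exact hv.le
    have e : ∀ c : ℝ, c = a * c + b * c := fun c => by rw [← add_mul, hab, one_mul]
    rcases hu with rfl | hu
    · rcases hv with rfl | hv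
      · left
        rw [← add_smul, hab, one_smul]
      · right
        simp only [PiLp.add_apply, PiLp.smul_apply, smul_eq_mul]
        rw [e (α * u 0 + β * u 1)]
        nlinarith [mul_lt_mul_of_pos_left hv hb]
    · right
      simp only [PiLp.add_apply, PiLp.smul_apply, smul_eq_mul]
      rw [e (α * x 0 + β * x 1)]
      nlinarith [mul_lt_mul_of_pos_left hu ha, mul_le_mul_of_nonneg_left hv' hb.le]
  have hhull : ∀ z ∈ convexHull ℝ S, z = x ∨ α * z 0 + β * z 1 < α * x 0 + β * x 1 := by
    intro z hz
    refine convexHull_min ?_ hconv hz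
    intro u hu
    by_cases hux : u = x
    · exact Or.inl hux
    · exact Or.inr (h u hu hux)
  rw [hullVertices, mem_extremePoints_iff_left]
  refine ⟨subset_convexHull ℝ S hx, ?_⟩
  rintro u hu v hv ⟨a, b, ha, hb, hab, hxuv⟩
  rcases hhull u hu with hu | hu
  · exact hu
  exfalso
  have hv' : α * v 0 + β * v 1 ≤ α * x 0 + β * x 1 := by
    rcases hhull v hv with rfl | hv
    · exact le_rfl
    · exact hv.le
  have e₀ : x 0 = a * u 0 + b * v 0 := by rw [← hxuv]; simp
  have e₁ : x 1 = a * u 1 + b * v 1 := by rw [← hxuv]; simp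
  have e : α * x 0 + β * x 1 = a * (α * u 0 + β * u 1) + b * (α * v 0 + β * v 1) := by
    rw [e₀, e₁]; ring
  have e' : α * x 0 + β * x 1 = a * (α * x 0 + β * x 1) + b * (α * x 0 + β * x 1) := by
    rw [← add_mul, hab, one_mul]
  nlinarith [mul_lt_mul_of_pos_left hu ha, mul_le_mul_of_nonneg_left hv' hb.le]

/-- A sufficient condition for a point to lie in the interior of a convex hull containing the
triangle with vertices `apex w`, `parab 0` and `parab c`. -/
theorem mem_interior_convexHull {S : Set Plane} {w c : ℝ} (hw : 0 < w) (hc : 0 < c)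
    (h₁ : apex w ∈ S) (h₂ : parab 0 ∈ S) (h₃ : parab c ∈ S) {x : Plane} (hx₁ : 0 < x 0)
    (hx₂ : x 1 < c * x 0) (hx₃ : x 0 / c + (c * x 0 - x 1) / w < 1) :
    x ∈ interior (convexHull ℝ S) := by
  rw [mem_interior]
  refine ⟨{z : Plane | 0 < z 0 ∧ z 1 < c * z 0 ∧ z 0 / c + (c * z 0 - z 1) / w < 1}, ?_, ?_,
    hx₁, hx₂, hx₃⟩
  · rintro z ⟨hz₁, hz₂, hz₃⟩
    -- Barycentric coordinates in the triangle; the three strict inequalities say that they are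
    -- positive.
    have e : z = (1 - z 0 / c - (c * z 0 - z 1) / w) • parab 0 + (z 0 / c) • parab c +
        ((c * z 0 - z 1) / w) • apex w := by
      ext i
      fin_cases i
      · simp
        field_simp
      · simp
        field_simp
        ring
    rw [e]
    have hconv := convex_convexHull ℝ S
    have := hconv.sum_mem (t := Finset.univ) (w := ![1 - z 0 / c - (c * z 0 - z 1) / w, z 0 / c,
      (c * z 0 - z 1) / w]) (z := ![parab 0, parab c, apex w]) ?_ ?_ ?_
    · simpa [Fin.sum_univ_three, add_assoc] using this
    · intro i _
      fin_cases i
      · simp only [Fin.zero_eta, Matrix.cons_val_zero]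
        linarith
      · exact (div_pos hz₁ hc).le
      · exact (div_pos (sub_pos.2 hz₂) hw).le
    · simp only [Fin.sum_univ_three, Matrix.cons_val]
      ring
    · intro i _
      fin_cases i
      · exact subset_convexHull ℝ S h₂
      · exact subset_convexHull ℝ S h₃
      · exact subset_convexHull ℝ S h₁
  · have c₀ : Continuous fun z : Plane => z 0 := by fun_prop
    have c₁ : Continuous fun z : Plane => z 1 := by fun_prop
    have c₂ : Continuous fun z : Plane => z 0 / c + (c * z 0 - z 1) / w := by fun_prop
    exact (isOpen_lt continuous_const c₀).inter ((isOpen_lt c₁ (continuous_const.mul c₀)).inter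
      (isOpen_lt c₂ continuous_const))

/-- The apex and the points of the parabola with abscissas `0, 1, …, N - 1`. -/
noncomputable def bluePoints (w : ℝ) (N : ℕ) : Finset Plane :=
  open Classical in insert (apex w) ((Finset.range N).image fun j : ℕ => parab j)

theorem mem_bluePoints {w : ℝ} {N : ℕ} {x : Plane} :
    x ∈ bluePoints w N ↔ x = apex w ∨ ∃ j < N, parab (j : ℕ) = x := by
  simp [bluePoints]

theorem apex_mem_bluePoints (w : ℝ) (N : ℕ) : apex w ∈ bluePoints w N :=
  mem_bluePoints.2 (Or.inl rfl)

theorem parab_mem_bluePoints (w : ℝ) {N j : ℕ} (h : j < N) : parab j ∈ bluePoints w N :=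
  mem_bluePoints.2 (Or.inr ⟨j, h, rfl⟩)

theorem parab_nat_injective : Function.Injective fun j : ℕ => parab j :=
  parab_injective.comp Nat.cast_injective

theorem card_bluePoints {w : ℝ} (hw : 0 < w) (N : ℕ) : (bluePoints w N).card = N + 1 := by
  classical
  rw [bluePoints, Finset.card_insert_of_notMem, Finset.card_image_of_injective _ parab_nat_injective,
    Finset.card_range]
  simp only [Finset.mem_image, not_exists, not_and]
  exact fun j _ h => parab_ne_apex hw _ h

section Hull

variable {w : ℝ} {N k : ℕ}

theorem parab_mem_interior (hw : ((k + 1) ^ 2 : ℝ) < w) (hN : k + 1 < N) {t : ℝ} (h₀ : 0 < t)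
    (h₁ : t < k + 1) : parab t ∈ interior (convexHull ℝ (bluePoints w N : Set Plane)) := by
  have hk0 : (0 : ℝ) ≤ k := Nat.cast_nonneg k
  have hw0 : 0 < w := by nlinarith
  refine mem_interior_convexHull (w := w) (c := (k + 1 : ℕ)) hw0 (by push_cast; linarith)
    (apex_mem_bluePoints w N) ?_ (parab_mem_bluePoints w hN) h₀ ?_ ?_
  · simpa using parab_mem_bluePoints w (j := 0) (N := N) (by omega)
  · simp only [parab_zero_coord, parab_one_coord]
    push_cast
    nlinarith
  · simp only [parab_zero_coord, parab_one_coord]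
    push_cast
    have h₂ : (0 : ℝ) < k + 1 := by linarith
    have h₃ : ((k : ℝ) + 1) * t - t ^ 2 = t * (k + 1 - t) := by ring
    have h₄ : t / w < 1 / (k + 1) := by
      rw [div_lt_div_iff₀ hw0 h₂]
      nlinarith
    have h₅ : t / w * (k + 1 - t) < 1 / (k + 1) * (k + 1 - t) :=
      mul_lt_mul_of_pos_right h₄ (by linarith)
    have h₆ : t / ((k : ℝ) + 1) + 1 / (k + 1) * (k + 1 - t) = 1 := by
      field_simp
      ring
    rw [h₃, mul_div_right_comm]
    linarith

theorem halfPoint_mem_interior (hN : 2 ≤ N) (hw : 1 < w) {y : ℝ} (hy₁ : (N : ℝ) - 2 < 2 * y)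
    (hy₂ : 2 * y < N - 1) :
    halfPoint y ∈ interior (convexHull ℝ (bluePoints w N : Set Plane)) := by
  have hcast : ((N - 1 : ℕ) : ℝ) = N - 1 := by
    rw [Nat.cast_sub (by omega), Nat.cast_one]
  have hN' : (2 : ℝ) ≤ N := by exact_mod_cast hN
  have hc : (0 : ℝ) < (N - 1 : ℕ) := by rw [hcast]; linarith
  refine mem_interior_convexHull (w := w) (c := (N - 1 : ℕ)) (by linarith) hc
    (apex_mem_bluePoints w N) ?_ (parab_mem_bluePoints w (by omega)) ?_ ?_ ?_
  · simpa using parab_mem_bluePoints w (j := 0) (N := N) (by omega)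
  · simp
  · simp only [halfPoint_zero_coord, halfPoint_one_coord, hcast]
    linarith
  · simp only [halfPoint_zero_coord, halfPoint_one_coord, hcast]
    have h₁ : 1 / 2 / ((N : ℝ) - 1) ≤ 1 / 2 := div_le_self (by norm_num) (by linarith)
    have h₂ : (((N : ℝ) - 1) * (1 / 2) - y) / w < 1 / 2 := by
      rw [div_lt_iff₀ (by linarith)]
      linarith
    linarith

theorem apex_mem_hullVertices (hw : 0 < w) :
    apex w ∈ hullVertices (bluePoints w N : Set Plane) := by
  refine mem_hullVertices_of_strict_max (apex_mem_bluePoints w N) 0 (-1) ?_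
  intro z hz hne
  obtain ⟨j, -, rfl⟩ := (mem_bluePoints.1 hz).resolve_left hne
  simp only [parab_zero_coord, parab_one_coord, apex_zero_coord, apex_one_coord]
  nlinarith [sq_nonneg (j : ℝ)]

theorem parab_zero_mem_hullVertices (hw : 0 < w) (hN : 0 < N) :
    parab (0 : ℕ) ∈ hullVertices (bluePoints w N : Set Plane) := by
  refine mem_hullVertices_of_strict_max (parab_mem_bluePoints w hN) (-N) 1 ?_
  intro z hz hne
  rcases mem_bluePoints.1 hz with rfl | ⟨j, hj, rfl⟩
  · simp only [parab_zero_coord, parab_one_coord, apex_zero_coord, apex_one_coord]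
    push_cast
    linarith
  · simp only [parab_zero_coord, parab_one_coord]
    have h₀ : 0 < j := Nat.pos_of_ne_zero fun h => hne (by rw [h])
    have h₁ : (0 : ℝ) < j := by exact_mod_cast h₀
    have h₂ : (j : ℝ) < N := by exact_mod_cast hj
    push_cast
    nlinarith

theorem parab_mem_hullVertices (hw : w < (k + 1) ^ 2 + 1 / 2) {j : ℕ} (hj : j < N)
    (hkj : k + 1 ≤ j) : parab j ∈ hullVertices (bluePoints w N : Set Plane) := by
  -- The tangent at `j` meets the axis at `-j ^ 2`, above the apex if `j = k + 1` and `w > (k + 1) ^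
  -- 2`. Steepening it by `1 / 2` drops it below the apex but keeps it below the points with integer
  -- abscissas other than `j`.
  refine mem_hullVertices_of_strict_max (parab_mem_bluePoints w hj) (2 * j + 1 / 2) (-1) ?_
  intro z hz hne
  have hk0 : (0 : ℝ) ≤ k := Nat.cast_nonneg k
  have hkj' : (k : ℝ) + 1 ≤ j := by exact_mod_cast hkj
  rcases mem_bluePoints.1 hz with rfl | ⟨i, hi, rfl⟩
  · simp only [parab_zero_coord, parab_one_coord, apex_zero_coord, apex_one_coord]
    nlinarith
  · simp only [parab_zero_coord, parab_one_coord]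
    have hij : i ≠ j := fun h => hne (by rw [h])
    rcases lt_or_gt_of_ne hij with h | h
    · have : (i : ℝ) + 1 ≤ j := by exact_mod_cast h
      nlinarith
    · have : (j : ℝ) + 1 ≤ i := by exact_mod_cast h
      nlinarith

theorem notMem_hullVertices_of_mem_interior {S : Set Plane} {x : Plane}
    (h : x ∈ interior (convexHull ℝ S)) : x ∉ hullVertices S :=
  Set.disjoint_left.1 (disjoint_interior_extremePoints _) h

theorem hullVertices_bluePoints (hw₁ : ((k + 1) ^ 2 : ℝ) < w) (hw₂ : w < (k + 1) ^ 2 + 1 / 2)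
    (hN : k + 1 < N) : hullVertices (bluePoints w N : Set Plane) =
      insert (apex w) ((fun j : ℕ => parab j) '' (insert 0 (Set.Ico (k + 1) N))) := by
  have hw0 : 0 < w := by nlinarith [sq_nonneg ((k : ℝ) + 1)]
  ext x
  constructor
  · intro hx
    rcases mem_bluePoints.1 (extremePoints_convexHull_subset hx) with rfl | ⟨j, hj, rfl⟩
    · exact Set.mem_insert _ _
    · refine Set.mem_insert_of_mem _ ⟨j, ?_, rfl⟩
      by_contra hcon
      simp only [Set.mem_insert_iff, Set.mem_Ico, not_or, not_and, not_lt] at hcon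
      have h₀ : 0 < j := Nat.pos_of_ne_zero hcon.1
      have h₁ : j < k + 1 := by
        by_contra! h
        exact absurd (hcon.2 h) (by omega)
      exact notMem_hullVertices_of_mem_interior (parab_mem_interior hw₁ hN
        (by exact_mod_cast h₀) (by exact_mod_cast h₁)) hx
  · rintro (rfl | ⟨j, rfl | hj, rfl⟩)
    · exact apex_mem_hullVertices hw0
    · exact parab_zero_mem_hullVertices hw0 (by omega)
    · exact parab_mem_hullVertices hw₂ hj.2 hj.1

theorem ncard_hullVertices_bluePoints (hw₁ : ((k + 1) ^ 2 : ℝ) < w)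
    (hw₂ : w < (k + 1) ^ 2 + 1 / 2) (hN : k + 1 < N) :
    (hullVertices (bluePoints w N : Set Plane)).ncard = N - k + 1 := by
  have hw0 : 0 < w := by nlinarith [sq_nonneg ((k : ℝ) + 1)]
  have hfin : (insert 0 (Set.Ico (k + 1) N)).Finite := (Set.finite_Ico _ _).insert _
  rw [hullVertices_bluePoints hw₁ hw₂ hN, Set.ncard_insert_of_notMem _ (hfin.image _),
    Set.ncard_image_of_injective _ parab_nat_injective,
    Set.ncard_insert_of_notMem (by simp) (Set.finite_Ico _ _), ← Finset.coe_Ico,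
    Set.ncard_coe_finset, Nat.card_Ico]
  · omega
  · rintro ⟨j, -, h⟩
    exact parab_ne_apex hw0 _ h

theorem ncard_interior_bluePoints (hw₁ : ((k + 1) ^ 2 : ℝ) < w) (hw₂ : w < (k + 1) ^ 2 + 1 / 2)
    (hN : k + 1 < N) : ((bluePoints w N : Set Plane) ∩
      interior (convexHull ℝ (bluePoints w N : Set Plane))).ncard = k := by
  have hw0 : 0 < w := by nlinarith [sq_nonneg ((k : ℝ) + 1)]
  have : (bluePoints w N : Set Plane) ∩ interior (convexHull ℝ (bluePoints w N : Set Plane)) =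
      (fun j : ℕ => parab j) '' (Finset.Icc 1 k : Finset ℕ) := by
    ext x
    constructor
    · rintro ⟨hx, hxi⟩
      have hxv := notMem_hullVertices_of_mem_interior hxi
      rw [hullVertices_bluePoints hw₁ hw₂ hN] at hxv
      rcases mem_bluePoints.1 hx with rfl | ⟨j, hj, rfl⟩
      · exact absurd (Set.mem_insert _ _) hxv
      · refine ⟨j, ?_, rfl⟩
        by_contra hcon
        refine hxv (Set.mem_insert_of_mem _ ⟨j, ?_, rfl⟩)
        simp only [Finset.coe_Icc, Set.mem_Icc, not_and, not_le, Set.mem_insert_iff,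
          Set.mem_Ico] at hcon ⊢
        omega
    · rintro ⟨j, hj, rfl⟩
      simp only [Finset.coe_Icc, Set.mem_Icc] at hj
      refine ⟨parab_mem_bluePoints w (by omega), parab_mem_interior hw₁ hN ?_ ?_⟩
      · exact_mod_cast hj.1
      · exact_mod_cast Nat.lt_succ_of_le hj.2
  rw [this, Set.ncard_image_of_injective _ parab_nat_injective, Set.ncard_coe_finset]
  simp

end Hull

/-! ### Red points and assembly. -/

/-- There is a set of any sufficiently large cardinality of rational non-integral abscissas between
`0` and `k + 1` that contains `j + 1 / 2` for all odd `j ≤ k`. -/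
theorem exists_abscissas {k c : ℕ} (hc : k ≤ 2 * c) : ∃ T : Finset ℚ, T.card = c ∧
    (∀ q ∈ T, 0 < q ∧ q < k + 1 ∧ ∀ n : ℕ, q ≠ n) ∧
    ∀ j : ℕ, Odd j → j ≤ k → (j + 1 / 2 : ℚ) ∈ T := by
  have hsub : Set.Ioo (0 : ℚ) 1 ⊆ {q : ℚ | 0 < q ∧ q < k + 1 ∧ ∀ n : ℕ, q ≠ n} := by
    rintro q ⟨h₀, h₁⟩
    have hk0 : (0 : ℚ) ≤ k := Nat.cast_nonneg k
    refine ⟨h₀, by linarith, ?_⟩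
    rintro n rfl
    have h₂ : 0 < n := by exact_mod_cast h₀
    have h₃ : n < 1 := by exact_mod_cast h₁
    omega
  have hinf := (Set.Ioo_infinite (zero_lt_one (α := ℚ))).mono hsub
  set T₀ : Finset ℚ := (Finset.range ((k + 1) / 2)).image fun i : ℕ => (2 * i + 1 + 1 / 2 : ℚ)
  have hT₀ : (T₀ : Set ℚ) ⊆ {q : ℚ | 0 < q ∧ q < k + 1 ∧ ∀ n : ℕ, q ≠ n} := by
    intro q hq
    obtain ⟨i, hi, rfl⟩ := Finset.mem_image.1 (Finset.mem_coe.1 hq)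
    rw [Finset.mem_range] at hi
    have h₁ : ((2 * i + 1 : ℕ) : ℚ) ≤ k := by exact_mod_cast (by omega : 2 * i + 1 ≤ k)
    push_cast at h₁
    refine ⟨by positivity, by linarith, ?_⟩
    intro n hn
    have h₂ : ((4 * i + 3 : ℕ) : ℚ) = (2 * n : ℕ) := by push_cast; linarith
    have h₃ := Nat.cast_injective h₂
    omega
  have hcard : T₀.card ≤ c := by
    refine Finset.card_image_le.trans ?_
    rw [Finset.card_range]
    omega
  obtain ⟨T₁, hT₁, hT₁card⟩ := (hinf.sdiff T₀.finite_toSet).exists_subset_card_eq (c - T₀.card)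
  refine ⟨T₀ ∪ T₁, ?_, ?_, ?_⟩
  · rw [Finset.card_union_of_disjoint, hT₁card]
    · omega
    · rw [Finset.disjoint_right]
      exact fun q hq => (hT₁ hq).2
  · intro q hq
    rcases Finset.mem_union.1 hq with hq | hq
    · exact hT₀ hq
    · exact (hT₁ hq).1
  · rintro j ⟨i, rfl⟩ hj
    refine Finset.mem_union_left _ (Finset.mem_image.2 ⟨i, Finset.mem_range.2 (by omega), ?_⟩)
    push_cast
    ring

theorem exists_isLabelled {m : ℕ} {p : Polygon Plane m} {w : ℝ} {N : ℕ} (hw : 0 < w)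
    (hp : IsPolygonization p (bluePoints w N : Set Plane)) :
    ∃ (s : Fin m) (J : Fin m → ℕ), IsLabelled p w N s J := by
  obtain ⟨hp, hrange⟩ := hp
  obtain ⟨s, hs⟩ : apex w ∈ Set.range p.vertices := hrange ▸ apex_mem_bluePoints w N
  have hex : ∀ i, i ≠ s → ∃ j < N, parab (j : ℕ) = p i := by
    intro i hi
    have hmem : p i ∈ (bluePoints w N : Set Plane) := hrange ▸ Set.mem_range_self i
    refine (mem_bluePoints.1 hmem).resolve_left fun h => hi (hp.injective (h.trans hs.symm))
  choose! J hJ using hex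
  refine ⟨s, J, hp, hs, fun i hi => (hJ i hi).2.symm, fun i hi => (hJ i hi).1, ?_⟩
  intro j hj
  obtain ⟨i, hi⟩ : parab j ∈ Set.range p.vertices := hrange ▸ parab_mem_bluePoints w hj
  have his : i ≠ s := by
    rintro rfl
    exact parab_ne_apex hw _ (hi.symm.trans hs)
  exact ⟨i, his, parab_nat_injective ((hJ i his).2.trans hi)⟩

theorem exists_configuration {n l k : ℕ} (hn : 3 ≤ n) (hl : 1 ≤ l) (hk : k ≤ 2 * l - 2) :
    ∃ B R : Finset Plane, IsConfiguration n k l B R ∧ ¬ HasExcludingPolygonization B R := by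
  classical
  obtain ⟨δ, hδ, hδ₀, hδ₁⟩ : ∃ δ : ℝ, Irrational δ ∧ 0 < δ ∧ δ < 1 / 2 := by
    obtain ⟨δ, hδ, h₀, h₁⟩ := exists_irrational_btwn (show (0 : ℝ) < 1 / 2 by norm_num)
    exact ⟨δ, hδ, h₀, h₁⟩
  obtain ⟨T, hTcard, hT, hTodd⟩ := exists_abscissas (k := k) (c := l - 1) (by omega)
  obtain ⟨N, hN⟩ : ∃ N, N + 1 = n + k := ⟨n + k - 1, by omega⟩
  set w : ℝ := (k + 1) ^ 2 + δ with hw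
  -- Using the same `δ` as in `w`, with opposite sign, makes `y + w` rational.
  set y : ℝ := (N - 1) / 2 - δ with hy
  have hk0 : (0 : ℝ) ≤ k := Nat.cast_nonneg k
  have hw₁ : ((k + 1) ^ 2 : ℝ) < w := by linarith
  have hw₂ : w < ((k + 1) ^ 2 + 1 / 2 : ℝ) := by linarith
  have hw₃ : 1 < w := by nlinarith
  have hw₀ : 0 < w := by linarith
  have hwq : ∀ q : ℚ, (q : ℝ) ≠ w := fun q h => hδ ⟨q - (k + 1) ^ 2, by
    push_cast
    linarith⟩
  have hyq : ∀ q : ℚ, (q : ℝ) ≠ y := fun q h => hδ ⟨(N - 1) / 2 - q, by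
    push_cast
    linarith⟩
  have hwy : y + w = (((N - 1) / 2 + (k + 1) ^ 2 : ℚ) : ℝ) := by
    push_cast
    linarith
  have hy₁ : (N : ℝ) - 2 < 2 * y := by linarith
  have hy₂ : 2 * y < N - 1 := by linarith
  have hkN : k + 1 < N := by omega
  have hinj : Function.Injective fun q : ℚ => parab q :=
    parab_injective.comp Rat.cast_injective
  set R : Finset Plane := insert (halfPoint y) (T.image fun q : ℚ => parab q) with hR
  have hRmem : ∀ x ∈ R, x = halfPoint y ∨ ∃ q ∈ T, parab (q : ℚ) = x := by
    intro x hx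
    simpa [hR] using hx
  have hhalf : ∀ q : ℚ, parab q ≠ halfPoint y := by
    intro q h
    have h₁ := congrArg (fun x : Plane => x 1) h
    simp only [parab_one_coord, halfPoint_one_coord] at h₁
    exact hyq (q ^ 2) (by push_cast; exact h₁)
  refine ⟨bluePoints w N, R, ⟨?_, ?_, ?_, ?_, ?_, ?_, ?_⟩, ?_⟩
  · rw [Finset.disjoint_left]
    intro x hxB hxR
    rcases hRmem x hxR with rfl | ⟨q, hq, rfl⟩
    · rcases mem_bluePoints.1 hxB with h | ⟨j, -, h⟩
      · have := congrArg (fun x : Plane => x 0) h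
        simp at this
      · exact hhalf j (by exact_mod_cast h)
    · rcases mem_bluePoints.1 hxB with h | ⟨j, -, h⟩
      · exact parab_ne_apex hw₀ _ h
      · refine (hT q hq).2.2 j ?_
        have := parab_injective h
        exact_mod_cast this.symm
  · refine (generalPosition_union hwq hyq hwy).mono ?_
    rintro x (hx | hx)
    · rcases mem_bluePoints.1 hx with rfl | ⟨j, -, rfl⟩
      · exact Or.inl (Or.inl rfl)
      · exact Or.inr ⟨j, by simp⟩
    · rcases hRmem x hx with rfl | ⟨q, -, rfl⟩
      · exact Or.inl (Or.inr rfl)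
      · exact Or.inr ⟨q, rfl⟩
  · rw [card_bluePoints hw₀, hN]
  · rw [hR, Finset.card_insert_of_notMem, Finset.card_image_of_injective _ hinj, hTcard]
    · omega
    · rw [Finset.mem_image]
      rintro ⟨q, -, h⟩
      exact hhalf q h
  · rw [ncard_hullVertices_bluePoints hw₁ hw₂ hkN]
    omega
  · exact ncard_interior_bluePoints hw₁ hw₂ hkN
  · intro x hx
    rcases hRmem x hx with rfl | ⟨q, hq, rfl⟩
    · exact halfPoint_mem_interior (by omega) hw₃ hy₁ hy₂
    · refine parab_mem_interior hw₁ hkN ?_ ?_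
      · exact_mod_cast (hT q hq).1
      · exact_mod_cast (hT q hq).2.1
  · rintro ⟨m, p, hp, hex⟩
    obtain ⟨s, J, h⟩ := exists_isLabelled hw₀ hp
    refine h.not_excluding (by omega) hw₁ hw₂ ?_ hy₁ hy₂ (hex (Finset.mem_insert_self _ _)) ?_
    · intro a b hab
      exact hwq (a * b) (by push_cast; exact hab)
    · intro j hj hjk
      refine hex (Finset.mem_insert_of_mem (Finset.mem_image.2 ⟨_, hTodd j hj hjk, ?_⟩))
      push_cast
      rfl

theorem theorem3 :
    (∀ n l k : ℕ, 3 ≤ n → 1 ≤ l → k ≤ 2 * l - 2 →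
      ∃ B R : Finset Plane, IsConfiguration n k l B R ∧ ¬ HasExcludingPolygonization B R) ∧
    (∀ l : ℕ, 1 ≤ l → ((2 * l - 1 : ℕ) : ℕ∞) ≤ minInterior l) := by
  refine ⟨fun n l k hn hl hk => exists_configuration hn hl hk, fun l hl => ?_⟩
  refine le_iInf₂ fun K hK => ?_
  by_contra! hlt
  have hlt : K < 2 * l - 1 := by exact_mod_cast hlt
  obtain ⟨B, R, hBR, hno⟩ := exists_configuration (n := 3) (k := 2 * l - 2) le_rfl hl le_rfl
  exact hno (hK 3 (2 * l - 2) B R le_rfl (by omega) hBR)
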